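/- Let $f\colon Y\to X$ be a continuous map of topological spaces that is separated (the diagonal is closed in $Y\times_X Y$) and locally proper (for every $y\in Y$ and every neighborhood $V$ of $y$ there are a neighborhood $A\subset V$ of $y$ and a neighborhood $U$ of $f(y)$ with $f(A)\subset U$ such that the induced map $A\to U$ is proper, i.e. universally closed). Write $\operatorname{Sh}(Y)$ for the category of sheaves of abelian groups on $Y$ and $D^+(Y)$ for the full subcategory of its derived category $D(\operatorname{Sh}(Y))$ consisting of the complexes whose cohomology sheaves are bounded below; similarly for $X$. Let $f_{(!)}\colon \operatorname{Sh}(Y)\to\operatorname{Sh}(X)$ be the proper direct image functor, $$(f_{(!)}\mathcal F)(U)=\{s\in\mathcal F(f^{-1}(U)) \mid f\colon \operatorname{supp}(s)\to U \text{ is proper}\},$$ and let $f_!=\mathrm R f_{(!)}\colon D^+(Y)\to D^+(X)$ be its right derived functor. Assume that $f_{(!)}$ has finite cohomological dimension, i.e. there is $d\in\mathbb N$ such that $\mathrm R^p f_{(!)}\mathcal F=0$ for all $p>d$ and all $\mathcal F\in\operatorname{Sh}(Y)$. Then $f_!\colon D^+(Y)\to D^+(X)$ has a right adjoint functor $f^!\colon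 D^+(X)\to D^+(Y)$. -/

import Mathlib

open CategoryTheory TopologicalSpace Opposite Topology

universe u w₁ w₂

/-- `f` maps `A` into `U`, and the induced map `A → U` of topological spaces (with the subspace
topologies) is proper. -/
def MapsProperly {Y X : Type*} [TopologicalSpace Y] [TopologicalSpace X]
    (f : Y → X) (A : Set Y) (U : Set X) : Prop :=
  ∃ h : Set.MapsTo f A U, IsProperMap (h.restrict f A U)

/-- Locally proper maps: `f` is continuous and every neighborhood `V` of a point `y` contains a
neighborhood `A` of `y` such that `f` induces a proper map from `A` to some neighborhood of
`f y`. -/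
def IsLocallyProperMap {Y X : Type*} [TopologicalSpace Y] [TopologicalSpace X]
    (f : Y → X) : Prop :=
  Continuous f ∧ ∀ y : Y, ∀ V ∈ 𝓝 y, ∃ A ∈ 𝓝 y, A ⊆ V ∧ ∃ U ∈ 𝓝 (f y), MapsProperly f A U

theorem mapsProperly_iff {Y X : Type*} [TopologicalSpace Y] [TopologicalSpace X]
    {f : Y → X} (hf : Continuous f) {A : Set Y} {U : Set X} :
    MapsProperly f A U ↔ Set.MapsTo f A U ∧ ∀ 𝒰 : Ultrafilter Y, A ∈ 𝒰 → ∀ x ∈ U,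
      Filter.Tendsto f 𝒰 (𝓝 x) → ∃ y ∈ A, f y = x ∧ (𝒰 : Filter Y) ≤ 𝓝 y := by
  refine ⟨fun ⟨h, hp⟩ ↦ ⟨h, fun 𝒰 hA x hx ht ↦ ?_⟩, fun ⟨h, hu⟩ ↦ ⟨h, ?_⟩⟩
  · have hr : Set.range (Subtype.val : A → Y) ∈ 𝒰 := by simpa using hA
    let 𝒱 : Ultrafilter A := 𝒰.comap Subtype.val_injective hr
    have h𝒱 : Filter.map Subtype.val (𝒱 : Filter A) = 𝒰 := by
      rw [Ultrafilter.coe_comap, Filter.map_comap_of_mem hr]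
    have ht' : Filter.Tendsto (h.restrict f A U) 𝒱 (𝓝 ⟨x, hx⟩) := by
      rw [nhds_subtype, Filter.tendsto_comap_iff]
      have : Filter.Tendsto f (Filter.map Subtype.val (𝒱 : Filter A)) (𝓝 x) := by rwa [h𝒱]
      exact this
    obtain ⟨y, hy, hle⟩ := hp.ultrafilter_le_nhds_of_tendsto ht'
    refine ⟨y, y.2, congrArg Subtype.val hy, ?_⟩
    rw [← h𝒱]
    exact (Filter.map_mono hle).trans continuous_subtype_val.continuousAt
  · refine isProperMap_iff_ultrafilter.mpr ⟨hf.restrict h, fun 𝒱 x ht ↦ ?_⟩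
    obtain ⟨y, hy, hyx, hle⟩ := hu (𝒱.map Subtype.val) (by
      rw [Ultrafilter.mem_map, Subtype.coe_preimage_self]
      exact Filter.univ_mem)
      x x.2 ((continuous_subtype_val.tendsto x).comp ht)
    refine ⟨⟨y, hy⟩, Subtype.ext hyx, ?_⟩
    rw [nhds_subtype, ← Filter.map_le_iff_le_comap]
    exact hle

section Support

variable {Y : TopCat.{u}}

/-- The support of a section `s` of an abelian presheaf over an open set `V`, as a subset of the
ambient space: the set of points of `V` at which the germ of `s` is nonzero. -/
def sectionSupport (F : TopCat.Presheaf AddCommGrpCat.{u} Y) {V : Opens Y} (s : F.obj (op V)) :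
    Set Y :=
  {y | ∃ hy : y ∈ V, F.germ V y hy s ≠ 0}

theorem not_mem_sectionSupport_iff {F : TopCat.Presheaf AddCommGrpCat.{u} Y} {V : Opens Y}
    {s : F.obj (op V)} {y : Y} (hy : y ∈ V) :
    y ∉ sectionSupport F s ↔ F.germ V y hy s = 0 := by
  simp [sectionSupport, hy]

/-- The support of a section over `V` is closed in `V`. -/
theorem mem_sectionSupport_of_ultrafilter {F : TopCat.Presheaf AddCommGrpCat.{u} Y} {V : Opens Y}
    {s : F.obj (op V)} {y : Y} (hy : y ∈ V) {𝒰 : Ultrafilter Y} (hle : (𝒰 : Filter Y) ≤ 𝓝 y)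
    (hs : sectionSupport F s ∈ 𝒰) : y ∈ sectionSupport F s := by
  by_contra hn
  rw [not_mem_sectionSupport_iff hy] at hn
  obtain ⟨W, hW, i, j, hij⟩ := F.germ_eq y hy hy s 0 (by rw [hn, map_zero])
  rw [map_zero] at hij
  have hW' : (W : Set Y) ∈ 𝒰 := hle (W.isOpen.mem_nhds hW)
  obtain ⟨z, ⟨hz, hzs⟩, hzW⟩ := 𝒰.nonempty_of_mem (Filter.inter_mem hs hW')
  apply hzs
  rw [← F.germ_res_apply i z hzW s, hij, map_zero]

theorem sectionSupport_zero (F : TopCat.Presheaf AddCommGrpCat.{u} Y) (V : Opens Y) :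
    sectionSupport F (0 : F.obj (op V)) = ∅ := by
  ext y
  simp [sectionSupport]

theorem sectionSupport_neg (F : TopCat.Presheaf AddCommGrpCat.{u} Y) {V : Opens Y}
    (s : F.obj (op V)) : sectionSupport F (-s) = sectionSupport F s := by
  ext y
  simp [sectionSupport]

theorem sectionSupport_add_subset (F : TopCat.Presheaf AddCommGrpCat.{u} Y) {V : Opens Y}
    (s t : F.obj (op V)) :
    sectionSupport F (s + t) ⊆ sectionSupport F s ∪ sectionSupport F t := by
  rintro y ⟨hy, h⟩
  by_contra hn
  rw [Set.mem_union, not_or, not_mem_sectionSupport_iff hy, not_mem_sectionSupport_iff hy] at hn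
  exact h (by rw [map_add, hn.1, hn.2, add_zero])

theorem sectionSupport_res (F : TopCat.Presheaf AddCommGrpCat.{u} Y) {V W : Opens Y}
    (i : W ⟶ V) (s : F.obj (op V)) :
    sectionSupport F (F.map i.op s) = sectionSupport F s ∩ W := by
  ext y
  constructor
  · rintro ⟨hy, h⟩
    rw [F.germ_res_apply i y hy s] at h
    exact ⟨⟨i.le hy, h⟩, hy⟩
  · rintro ⟨⟨hy, h⟩, hyW⟩
    exact ⟨hyW, by rwa [F.germ_res_apply i y hyW s]⟩

theorem sectionSupport_map_subset {F G : TopCat.Presheaf AddCommGrpCat.{u} Y} (φ : F ⟶ G)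
    {V : Opens Y} (s : F.obj (op V)) :
    sectionSupport G (φ.app (op V) s) ⊆ sectionSupport F s := by
  rintro y ⟨hy, h⟩
  refine ⟨hy, fun h0 ↦ h ?_⟩
  rw [← TopCat.Presheaf.stalkFunctor_map_germ_apply, h0]
  exact map_zero ((TopCat.Presheaf.stalkFunctor AddCommGrpCat.{u} y).map φ).hom

end Support

section ProperDirectImage

variable {Y X : TopCat.{u}} (f : Y ⟶ X)

/-- If a section has support contained in the union of two supports that are proper over `U`, then
its support is proper over `U`. -/
theorem mapsProperly_sectionSupport_of_subset
    {F G H : TopCat.Presheaf AddCommGrpCat.{u} Y} {U : Opens X}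
    {r : H.obj (op ((Opens.map f).obj U))} {s : F.obj (op ((Opens.map f).obj U))}
    {t : G.obj (op ((Opens.map f).obj U))}
    (h : sectionSupport H r ⊆ sectionSupport F s ∪ sectionSupport G t)
    (hs : MapsProperly f (sectionSupport F s) U) (ht : MapsProperly f (sectionSupport G t) U) :
    MapsProperly f (sectionSupport H r) U := by
  rw [mapsProperly_iff f.hom.continuous] at hs ht ⊢
  refine ⟨fun y hy ↦ (h hy).elim (fun h' ↦ hs.1 h') (fun h' ↦ ht.1 h'), fun 𝒰 hr x hx hlim ↦ ?_⟩
  have key : ∃ y, f y = x ∧ (𝒰 : Filter Y) ≤ 𝓝 y := by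
    rcases Ultrafilter.union_mem_iff.mp (Filter.mem_of_superset hr h) with h' | h'
    · obtain ⟨y, -, hy⟩ := hs.2 𝒰 h' x hx hlim
      exact ⟨y, hy⟩
    · obtain ⟨y, -, hy⟩ := ht.2 𝒰 h' x hx hlim
      exact ⟨y, hy⟩
  obtain ⟨y, hyx, hle⟩ := key
  have hyU : y ∈ (Opens.map f).obj U := by
    change f y ∈ U
    rw [hyx]
    exact hx
  exact ⟨y, mem_sectionSupport_of_ultrafilter hyU hle hr, hyx, hle⟩

/-- The group of sections `s ∈ F(f⁻¹(U))` such that `f : supp s → U` is proper. -/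
def properSections (F : TopCat.Presheaf AddCommGrpCat.{u} Y) (U : Opens X) :
    AddSubgroup (F.obj (op ((Opens.map f).obj U))) where
  carrier := {s | MapsProperly f (sectionSupport F s) U}
  zero_mem' := by
    rw [Set.mem_ofPred_eq, sectionSupport_zero, mapsProperly_iff f.hom.continuous]
    exact ⟨Set.mapsTo_empty _ _, fun 𝒰 h ↦ absurd h 𝒰.empty_notMem⟩
  add_mem' {s t} hs ht :=
    mapsProperly_sectionSupport_of_subset f (sectionSupport_add_subset F s t) hs ht
  neg_mem' {s} hs := by
    rw [Set.mem_ofPred_eq, sectionSupport_neg]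
    exact hs

theorem mem_properSections {F : TopCat.Presheaf AddCommGrpCat.{u} Y} {U : Opens X}
    {s : F.obj (op ((Opens.map f).obj U))} :
    s ∈ properSections f F U ↔ MapsProperly f (sectionSupport F s) U := Iff.rfl

theorem map_mem_properSections {F : TopCat.Presheaf AddCommGrpCat.{u} Y} {U W : Opens X}
    (i : W ⟶ U) {s : F.obj (op ((Opens.map f).obj U))} (hs : s ∈ properSections f F U) :
    F.map ((Opens.map f).map i).op s ∈ properSections f F W := by
  rw [mem_properSections, mapsProperly_iff f.hom.continuous] at hs ⊢
  rw [sectionSupport_res]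
  refine ⟨fun y hy ↦ hy.2, fun 𝒰 h x hx hlim ↦ ?_⟩
  obtain ⟨y, hy, hyx, hle⟩ := hs.2 𝒰 (Filter.mem_of_superset h Set.inter_subset_left) x
    (i.le hx) hlim
  refine ⟨y, ⟨hy, ?_⟩, hyx, hle⟩
  change f y ∈ W
  rw [hyx]
  exact hx

theorem app_mem_properSections {F G : TopCat.Presheaf AddCommGrpCat.{u} Y} (φ : F ⟶ G)
    {U : Opens X} {s : F.obj (op ((Opens.map f).obj U))} (hs : s ∈ properSections f F U) :
    φ.app (op ((Opens.map f).obj U)) s ∈ properSections f G U :=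
  mapsProperly_sectionSupport_of_subset f
    ((sectionSupport_map_subset φ s).trans (Set.subset_union_left (t := sectionSupport F s))) hs hs

/-- Properness of the support can be checked locally on the target. -/
theorem mem_properSections_of_cover {F : TopCat.Presheaf AddCommGrpCat.{u} Y} {ι : Type*}
    {U : ι → Opens X} {s : F.obj (op ((Opens.map f).obj (iSup U)))}
    (h : ∀ i, F.map ((Opens.map f).map (Opens.leSupr U i)).op s ∈ properSections f F (U i)) :
    s ∈ properSections f F (iSup U) := by
  rw [mem_properSections, mapsProperly_iff f.hom.continuous]
  refine ⟨fun y hy ↦ hy.1, fun 𝒰 hs x hx hlim ↦ ?_⟩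
  obtain ⟨i, hi⟩ := Opens.mem_iSup.mp hx
  have h' := h i
  rw [mem_properSections, mapsProperly_iff f.hom.continuous, sectionSupport_res] at h'
  obtain ⟨y, hy, hyx, hle⟩ := h'.2 𝒰
    (Filter.inter_mem hs (hlim ((U i).isOpen.mem_nhds hi))) x hi hlim
  exact ⟨y, hy.1, hyx, hle⟩

/-- The presheaf `U ↦ {s ∈ F(f⁻¹(U)) | f : supp s → U is proper}`, with the restriction maps
of `F`. -/
noncomputable def properDirectImagePresheaf (F : TopCat.Presheaf AddCommGrpCat.{u} Y) :
    TopCat.Presheaf AddCommGrpCat.{u} X where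
  obj U := AddCommGrpCat.of (properSections f F U.unop)
  map {U W} i := AddCommGrpCat.ofHom
    (((F.map ((Opens.map f).map i.unop).op).hom.comp (properSections f F U.unop).subtype).codRestrict
      (properSections f F W.unop) (fun s ↦ map_mem_properSections f i.unop s.2))
  map_id U := by
    ext s
    change F.map (𝟙 _) s.1 = s.1
    rw [F.map_id]
    rfl
  map_comp {U V W} i j := by
    ext s
    change F.map (((Opens.map f).map i.unop).op ≫ ((Opens.map f).map j.unop).op) s.1 = _
    rw [F.map_comp]
    rfl

theorem properDirectImagePresheaf_isSheaf (F : TopCat.Sheaf AddCommGrpCat.{u} Y) :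
    (properDirectImagePresheaf f F.obj).IsSheaf := by
  rw [TopCat.Presheaf.isSheaf_iff_isSheafUniqueGluing]
  intro ι U sf hsf
  have hcover : (Opens.map f).obj (iSup U) ≤ ⨆ i, (Opens.map f).obj (U i) := by
    intro y hy
    obtain ⟨i, hi⟩ := Opens.mem_iSup.mp (show f y ∈ iSup U from hy)
    exact Opens.mem_iSup.mpr ⟨i, hi⟩
  obtain ⟨s, hs, huniq⟩ := F.existsUnique_gluing' (fun i ↦ (Opens.map f).obj (U i))
    ((Opens.map f).obj (iSup U)) (fun i ↦ (Opens.map f).map (Opens.leSupr U i)) hcover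
    (fun i ↦ (sf i).1) (fun i j ↦ congrArg Subtype.val (hsf i j))
  refine ⟨⟨s, mem_properSections_of_cover f fun i ↦ ?_⟩, fun i ↦ Subtype.ext (hs i),
    fun t ht ↦ Subtype.ext (huniq t.1 fun i ↦ congrArg Subtype.val (ht i))⟩
  have := hs i
  dsimp only at this
  rw [this]
  exact (sf i).2

/-- The proper direct image functor `f_(!) : Sh(Y) ⥤ Sh(X)` on sheaves of abelian groups,
`(f_(!) F)(U) = {s ∈ F(f⁻¹(U)) | f : supp s → U is proper}`. -/
noncomputable def properDirectImage :
    TopCat.Sheaf AddCommGrpCat.{u} Y ⥤ TopCat.Sheaf AddCommGrpCat.{u} X where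
  obj F := ⟨properDirectImagePresheaf f F.obj, properDirectImagePresheaf_isSheaf f F⟩
  map {F G} φ := ⟨{
    app := fun U ↦ AddCommGrpCat.ofHom
      (((φ.hom.app (op ((Opens.map f).obj U.unop))).hom.comp
        (properSections f F.obj U.unop).subtype).codRestrict
          (properSections f G.obj U.unop) (fun s ↦ app_mem_properSections f φ.hom s.2))
    naturality := fun U W i ↦ by
      ext s
      apply Subtype.ext
      exact NatTrans.naturality_apply φ.hom ((Opens.map f).map i.unop).op s.1 }⟩
  map_id F := rfl
  map_comp φ ψ := rfl

instance : (properDirectImage f).Additive where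
  map_add := rfl

/-- The functor `f_(!)` has finite cohomological dimension: there is a natural number `d` such
that the right derived functors `R^p f_(!)` vanish for all `p > d`. -/
def HasFiniteCohomologicalDimension : Prop :=
  ∃ d : ℕ, ∀ p : ℕ, d < p → ∀ F : TopCat.Sheaf AddCommGrpCat.{u} Y,
    Limits.IsZero (((properDirectImage f).rightDerived p).obj F)

/-- The derived proper direct image functor `f_! = R f_(!) : D⁺(Y) ⥤ D⁺(X)` between the
bounded below derived categories of sheaves of abelian groups. -/
noncomputable def derivedProperDirectImage [HasDerivedCategory.{w₁} (TopCat.Sheaf AddCommGrpCat.{u} Y)]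
    [HasDerivedCategory.{w₂} (TopCat.Sheaf AddCommGrpCat.{u} X)] :
    DerivedCategory.Plus (TopCat.Sheaf AddCommGrpCat.{u} Y) ⥤
      DerivedCategory.Plus (TopCat.Sheaf AddCommGrpCat.{u} X) :=
  (properDirectImage f).rightDerivedFunctorPlus

end ProperDirectImage

/-! A functor on complexes over a Grothendieck abelian category that preserves colimits has a right
adjoint. If it also preserves monomorphisms and quasi-isomorphisms, this right adjoint can be
derived along complexes of injectives, and the adjunction descends to derived categories. The proper
direct image `F` is only left exact and compatible with coproducts; the task is to replace it by
such a functor `Φ` on complexes that still computes its right derived functor.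

Finite cohomological dimension makes this possible. Let `T M` be `M ⊗ B`, with `B` the sheaf of
integer functions that locally have finitely many values. Then `T` is exact and cocontinuous, `M`
embeds naturally in `T M`, and `T M` is `f`-soft, because characteristic functions of arbitrary
subsets act on it and cut sections off along proper neighborhoods (`isSoft_finSheaf`). Soft sheaves
include the injectives, are stable under quotients by soft sheaves, and `F` preserves short exact
sequences starting with one (`isAdaptedClass_isSoft`). The cokernel `Q` of `𝟭 ⟶ T` is again exact
and cocontinuous, and dimension shifting kills the first derived functor of `F` on `Q^d M` for every
`M`. Truncating gives the coresolution `0 → M → T M → T Q M → … → T Q^(d-1) M → Q^d M → 0`, in which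
`F T Q^i` and `F Q^d` are exact and preserve coproducts, hence all colimits. Their total complex,
formed by iterated mapping cocones in `exists_isCocontinuousExact`, is `Φ`.

On complexes of injectives `F K ⟶ Φ K` is a quasi-isomorphism, so `Φ` induces the right derived
functor (`nonempty_rightDerivedFunctorPlus_iso`). As `Φ` raises upper bounds by a fixed amount, its
right adjoint preserves bounded below complexes (`isStrictlyGE_of_adjunction`); as `Φ` preserves
monomorphisms, that adjoint respects quasi-isomorphisms between complexes of injectives
(`quasiIso_map_of_adjunction`). -/

namespace CategoryTheory

open Limits

/-! ### Dimension shifting with respect to an adapted class -/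

section ExtensionVanishing

variable {A B : Type*} [Category* A] [Category* B] [Abelian A] [Abelian B]

/-- The pushout of a short exact sequence along a morphism from its first term. -/
lemma shortExact_pushout {M S N X : A} {f : M ⟶ S} {g : S ⟶ N} {w : f ≫ g = 0}
    (h : (ShortComplex.mk f g w).ShortExact) (i : M ⟶ X) :
    (ShortComplex.mk (pushout.inr f i) (pushout.desc g 0 (by rw [w, comp_zero]))
      (by rw [pushout.inr_desc])).ShortExact := by
  have hf : Mono f := h.mono_f
  have hg : Epi g := h.epi_g
  have : Epi (pushout.desc g (0 : X ⟶ N) (by rw [w, comp_zero]) : pushout f i ⟶ N) := by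
    have : Epi (pushout.inl f i ≫ pushout.desc g (0 : X ⟶ N) (by rw [w, comp_zero])) := by
      rwa [pushout.inl_desc]
    exact epi_of_epi (pushout.inl f i) _
  refine ShortComplex.ShortExact.mk' (ShortComplex.exact_of_g_is_cokernel _
    (CokernelCofork.IsColimit.ofπ' _ _ fun t ht ↦ ?_)) (by dsimp; infer_instance) this
  refine ⟨h.exact.desc (pushout.inl f i ≫ t) (by
    dsimp at ht ⊢; rw [pushout.condition_assoc, ht, comp_zero]), ?_⟩
  dsimp
  ext
  · rw [pushout.inl_desc_assoc]
    exact h.exact.g_desc _ _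
  · rw [pushout.inr_desc_assoc, zero_comp]
    exact ht.symm

/-- Given two short exact sequences `0 ⟶ M ⟶ S ⟶ N ⟶ 0` and `0 ⟶ M ⟶ X ⟶ Y ⟶ 0`, the pushout of
`M ⟶ S` and `M ⟶ X` is an extension of `N` by `X` and of `Y` by `S`. -/
lemma exists_pushout_of_shortExact {M S N X Y : A} {f : M ⟶ S} {g : S ⟶ N} {w : f ≫ g = 0}
    (h : (ShortComplex.mk f g w).ShortExact) {i : M ⟶ X} {p : X ⟶ Y} {w' : i ≫ p = 0}
    (h' : (ShortComplex.mk i p w').ShortExact) :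
    ∃ (P : A) (a : S ⟶ P) (b : X ⟶ P) (q : P ⟶ N) (r : P ⟶ Y) (w₁ : b ≫ q = 0) (w₂ : a ≫ r = 0),
      a ≫ q = g ∧ b ≫ r = p ∧ (ShortComplex.mk b q w₁).ShortExact ∧
        (ShortComplex.mk a r w₂).ShortExact := by
  refine ⟨pushout f i, pushout.inl f i, pushout.inr f i, pushout.desc g 0 (by rw [w, comp_zero]),
    pushout.desc 0 p (by rw [w', comp_zero]), by rw [pushout.inr_desc], by rw [pushout.inl_desc],
    by rw [pushout.inl_desc], by rw [pushout.inr_desc], shortExact_pushout h i, ?_⟩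
  refine ShortComplex.shortExact_of_iso (S₁ := ShortComplex.mk (pushout.inr i f)
    (pushout.desc p 0 (by rw [w', comp_zero])) (by rw [pushout.inr_desc]))
    (ShortComplex.isoMk (Iso.refl _) (pushoutSymmetry i f) (Iso.refl _) ?_ ?_)
    (shortExact_pushout h' f)
  · simp
  · dsimp
    ext
    · simp [pushout.inl_desc, pushout.inr_desc]
    · simp [pushout.inl_desc, pushout.inr_desc]

/-- For a composition of monomorphisms `S ⟶ P ⟶ I`, the quotient of `I / S` by `P / S` is
`I / P`. -/
lemma exists_quotient_of_shortExact {S P N I Z : A} {f : S ⟶ P} {g : P ⟶ N} {w : f ≫ g = 0}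
    (h : (ShortComplex.mk f g w).ShortExact) {i : P ⟶ I} {p : I ⟶ Z} {w' : i ≫ p = 0}
    (h' : (ShortComplex.mk i p w').ShortExact) :
    ∃ (C : A) (a : I ⟶ C) (b : N ⟶ C) (r : C ⟶ Z) (w₁ : (f ≫ i) ≫ a = 0) (w₂ : b ≫ r = 0),
      a ≫ r = p ∧ (ShortComplex.mk (f ≫ i) a w₁).ShortExact ∧
        (ShortComplex.mk b r w₂).ShortExact := by
  have hf : Mono f := h.mono_f
  have hg : Epi g := h.epi_g
  have hi : Mono i := h'.mono_f
  refine ⟨pushout i g, pushout.inl i g, pushout.inr i g, pushout.desc p 0 (by rw [w', comp_zero]),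
    by rw [Category.assoc, pushout.condition, reassoc_of% w, zero_comp], by rw [pushout.inr_desc],
    by rw [pushout.inl_desc], ?_, shortExact_pushout h' g⟩
  refine ShortComplex.ShortExact.mk' (ShortComplex.exact_of_g_is_cokernel _
    (CokernelCofork.IsColimit.ofπ' _ _ fun t ht ↦ ?_)) (by dsimp; infer_instance)
    (by dsimp; infer_instance)
  have ht' : f ≫ i ≫ t = 0 := by simpa using ht
  have hd : g ≫ h.exact.desc (i ≫ t) ht' = i ≫ t := h.exact.g_desc _ _
  exact ⟨pushout.desc t (h.exact.desc (i ≫ t) ht') hd.symm, pushout.inl_desc _ _ _⟩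

lemma exists_shortExact_injective [EnoughInjectives A] (M : A) :
    ∃ (I Z : A) (i : M ⟶ I) (p : I ⟶ Z) (w : i ≫ p = 0), (ShortComplex.mk i p w).ShortExact ∧
      Injective I :=
  ⟨Injective.under M, cokernel (Injective.ι M), Injective.ι M, cokernel.π _, by simp,
    ShortComplex.ShortExact.mk' (ShortComplex.exact_cokernel _) (by dsimp; infer_instance)
      (by dsimp; infer_instance), inferInstance⟩

variable (F : A ⥤ B) [F.Additive]

/-- `F` preserves the exactness of all short exact sequences with first term `M`. (For a left
exact functor this is the vanishing of `R¹F M`.) -/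
def PreservesEpiOfExtension (M : A) : Prop :=
  ∀ ⦃X Y : A⦄ (f : M ⟶ X) (g : X ⟶ Y) (w : f ≫ g = 0),
    (ShortComplex.mk f g w).ShortExact → Epi (F.map g)

variable {F}

/-- This is the segment `F S → F N → R¹F M → R¹F S` of the long exact sequence, proved without
derived functors: a second extension of `M` is compared with the given one through their pushout. -/
lemma PreservesEpiOfExtension.of_shortExact [PreservesFiniteLimits F] {M S N : A} {f : M ⟶ S}
    {g : S ⟶ N} {w : f ≫ g = 0}
    (h : (ShortComplex.mk f g w).ShortExact) (hS : PreservesEpiOfExtension F S)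
    (hg : Epi (F.map g)) : PreservesEpiOfExtension F M := by
  intro X Y i p w' h'
  obtain ⟨P, a, b, q, r, w₁, w₂, haq, hbr, hb, ha⟩ := exists_pushout_of_shortExact h h'
  have hr := hS a r w₂ ha
  have hb' := hb.mono_f
  dsimp at hb'
  have hex : (ShortComplex.mk (F.map b) (F.map q)
      (by rw [← F.map_comp, w₁, F.map_zero])).Exact := (hb.exact.map_of_mono_of_preservesKernel F
        inferInstance inferInstance)
  rw [epi_iff_surjective_up_to_refinements]
  intro T y
  obtain ⟨T₁, π₁, _, x₁, hx₁⟩ := surjective_up_to_refinements_of_epi (F.map r) y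
  obtain ⟨T₂, π₂, _, s, hs⟩ := surjective_up_to_refinements_of_epi (F.map g) (x₁ ≫ F.map q)
  -- Subtracting the contribution of `F S` kills the image in `F N` and does not change the image in
  -- `F Y`, since `a ≫ r = 0`; the difference therefore comes from `F X`.
  have h0 : (π₂ ≫ x₁ - s ≫ F.map a) ≫ F.map q = 0 := by
    rw [Preadditive.sub_comp, Category.assoc, hs, Category.assoc, ← F.map_comp, haq, sub_self]
  refine ⟨T₂, π₂ ≫ π₁, inferInstance, hex.lift (π₂ ≫ x₁ - s ≫ F.map a) h0, ?_⟩
  have h1 : hex.lift (π₂ ≫ x₁ - s ≫ F.map a) h0 ≫ F.map b = π₂ ≫ x₁ - s ≫ F.map a :=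
    hex.lift_f _ _
  simp only [← hbr, F.map_comp]
  rw [reassoc_of% h1, Preadditive.sub_comp, Category.assoc, Category.assoc,
    ← hx₁, Category.assoc, ← F.map_comp a, w₂, F.map_zero, comp_zero, sub_zero]

variable (F) in
/-- A class of objects which is adapted to computing the right derived functors of a left exact
functor `F`: it contains the injective objects, is stable under quotients by its members, and `F`
preserves short exact sequences whose first term belongs to it. -/
structure IsAdaptedClass (P : ObjectProperty A) : Prop where
  injective (I : A) [Injective I] : P I
  quotient (S : ShortComplex A) (hS : S.ShortExact) (h₁ : P S.X₁) (h₂ : P S.X₂) : P S.X₃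
  epi_map (S : ShortComplex A) (hS : S.ShortExact) (h₁ : P S.X₁) : Epi (F.map S.g)

variable (F) in
/-- `M` has a coresolution of length `n` by objects in `P` up to an object on which the first
derived functor of `F` vanishes. -/
def HasAdaptedDimensionLE (P : ObjectProperty A) : ℕ → A → Prop
  | 0, M => PreservesEpiOfExtension F M
  | n + 1, M => ∃ (S N : A) (f : M ⟶ S) (g : S ⟶ N) (w : f ≫ g = 0),
      (ShortComplex.mk f g w).ShortExact ∧ P S ∧ HasAdaptedDimensionLE P n N

namespace IsAdaptedClass

variable {P : ObjectProperty A} (hP : IsAdaptedClass F P)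

include hP

omit [Abelian B] [F.Additive] in
lemma preservesEpiOfExtension {S : A} (hS : P S) : PreservesEpiOfExtension F S :=
  fun _ _ _ _ _ h ↦ hP.epi_map _ h hS

variable [PreservesFiniteLimits F] [EnoughInjectives A]

/-- Embed `X` in an injective `I`, with quotient `Z`. Then `C = I / S` is adapted, `N` embeds in `C`
with the same quotient `Z`, and `F I → F C` is epi. So `F I → F Z` is epi exactly when `F C → F Z`
is. -/
lemma preservesEpiOfExtension_iff {S X N : A} {f : S ⟶ X} {g : X ⟶ N} {w : f ≫ g = 0}
    (h : (ShortComplex.mk f g w).ShortExact) (hS : P S) :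
    PreservesEpiOfExtension F X ↔ PreservesEpiOfExtension F N := by
  obtain ⟨I, Z, i, p, w', h', hI⟩ := exists_shortExact_injective X
  obtain ⟨C, a, b, r, w₁, w₂, har, ha, hb⟩ := exists_quotient_of_shortExact h h'
  have hC : P C := hP.quotient _ ha hS (hP.injective I)
  have haF : Epi (F.map a) := hP.epi_map _ ha hS
  constructor
  · intro hX
    have := hX i p w' h'
    rw [← har, F.map_comp] at this
    exact .of_shortExact hb (hP.preservesEpiOfExtension hC) (epi_of_epi (F.map a) _)
  · intro hN
    have := hN b r w₂ hb
    refine .of_shortExact h' (hP.preservesEpiOfExtension (hP.injective I)) ?_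
    rw [← har, F.map_comp]
    infer_instance

/-- The two claims support each other. Invariance under quotients by adapted objects in dimension
`n` gives independence of the chosen embedding, by comparing two embeddings of `M` in their pushout;
independence in dimension `n` gives invariance in dimension `n + 1`. -/
lemma hasAdaptedDimensionLE_aux (n : ℕ) :
    (∀ {S X N : A} {f : S ⟶ X} {g : X ⟶ N} {w : f ≫ g = 0},
      (ShortComplex.mk f g w).ShortExact → P S →
        (HasAdaptedDimensionLE F P n X ↔ HasAdaptedDimensionLE F P n N)) ∧
    (∀ {M S N : A} {f : M ⟶ S} {g : S ⟶ N} {w : f ≫ g = 0},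
      (ShortComplex.mk f g w).ShortExact → P S → HasAdaptedDimensionLE F P (n + 1) M →
        HasAdaptedDimensionLE F P n N) := by
  have key (n : ℕ) (hn : ∀ {S X N : A} {f : S ⟶ X} {g : X ⟶ N} {w : f ≫ g = 0},
      (ShortComplex.mk f g w).ShortExact → P S →
        (HasAdaptedDimensionLE F P n X ↔ HasAdaptedDimensionLE F P n N)) :
      ∀ {M S N : A} {f : M ⟶ S} {g : S ⟶ N} {w : f ≫ g = 0},
        (ShortComplex.mk f g w).ShortExact → P S → HasAdaptedDimensionLE F P (n + 1) M →
          HasAdaptedDimensionLE F P n N := by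
    intro M S N f g w h hS ⟨S', N', f', g', w', h', hS', hN'⟩
    obtain ⟨_, a, b, q, r, w₁, w₂, -, -, hb, ha⟩ := exists_pushout_of_shortExact h h'
    exact (hn hb hS').1 ((hn ha hS).2 hN')
  induction n with
  | zero =>
    have h0 : ∀ {S X N : A} {f : S ⟶ X} {g : X ⟶ N} {w : f ≫ g = 0},
      (ShortComplex.mk f g w).ShortExact → P S →
        (HasAdaptedDimensionLE F P 0 X ↔ HasAdaptedDimensionLE F P 0 N) :=
      fun h hS ↦ hP.preservesEpiOfExtension_iff h hS
    exact ⟨h0, key 0 h0⟩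
  | succ n hn =>
    have h0 : ∀ {S X N : A} {f : S ⟶ X} {g : X ⟶ N} {w : f ≫ g = 0},
        (ShortComplex.mk f g w).ShortExact → P S →
          (HasAdaptedDimensionLE F P (n + 1) X ↔ HasAdaptedDimensionLE F P (n + 1) N) := by
      intro S X N f g w h hS
      constructor
      · rintro ⟨S₁, X₁, i, p, w', h', hS₁, hX₁⟩
        obtain ⟨C, a, b, r, w₁, w₂, har, ha, hb⟩ := exists_quotient_of_shortExact h h'
        exact ⟨C, X₁, b, r, w₂, hb, hP.quotient _ ha hS hS₁, hX₁⟩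
      · intro hN
        obtain ⟨I, Z, i, p, w', h', hI⟩ := exists_shortExact_injective X
        obtain ⟨C, a, b, r, w₁, w₂, har, ha, hb⟩ := exists_quotient_of_shortExact h h'
        exact ⟨I, Z, i, p, w', h', hP.injective I,
          hn.2 hb (hP.quotient _ ha hS (hP.injective I)) hN⟩
    exact ⟨h0, key (n + 1) h0⟩

/-- The dimension drops by one when passing to the quotient by an embedding into an adapted
object. -/
lemma hasAdaptedDimensionLE_of_succ {n : ℕ} {M S N : A} {f : M ⟶ S} {g : S ⟶ N} {w : f ≫ g = 0}
    (h : (ShortComplex.mk f g w).ShortExact) (hS : P S)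
    (hM : HasAdaptedDimensionLE F P (n + 1) M) : HasAdaptedDimensionLE F P n N :=
  (hP.hasAdaptedDimensionLE_aux n).2 h hS hM

omit hP [F.Additive] [EnoughInjectives A] in
lemma epi_map_of_exact {X Y Z W : A} {f : X ⟶ Y} {g : Y ⟶ W} {k : Z ⟶ Y} {e : X ⟶ Z}
    [Mono k] (he : e ≫ k = f) (hk : k ≫ g = 0) {w : F.map f ≫ F.map g = 0}
    (hF : (ShortComplex.mk (F.map f) (F.map g) w).Exact) [F.PreservesZeroMorphisms] :
    Epi (F.map e) := by
  rw [epi_iff_surjective_up_to_refinements]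
  intro T y
  obtain ⟨T', π, hπ, x, hx⟩ := hF.exact_up_to_refinements (y ≫ F.map k) (by
    dsimp
    rw [Category.assoc, ← F.map_comp, hk, F.map_zero, comp_zero])
  refine ⟨T', π, hπ, x, ?_⟩
  rw [← cancel_mono (F.map k), Category.assoc, Category.assoc, ← F.map_comp, he]
  exact hx

omit hP [EnoughInjectives A] [PreservesFiniteLimits F] [F.Additive] in
lemma shortExact_of_injectiveResolution {M : A} (I : InjectiveResolution M) (n : ℕ)
    {Z : A} (k : Z ⟶ I.cocomplex.X n) [Mono k] (w : k ≫ I.cocomplex.d n (n + 1) = 0)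
    (hk : (ShortComplex.mk _ _ w).Exact) :
    ∃ (e : I.cocomplex.X n ⟶ kernel (I.cocomplex.d (n + 1) (n + 2))) (hke : k ≫ e = 0),
      e ≫ kernel.ι _ = I.cocomplex.d n (n + 1) ∧ (ShortComplex.mk k e hke).ShortExact := by
  have hex := I.exact_succ n
  let e := kernel.lift (I.cocomplex.d (n + 1) (n + 2)) (I.cocomplex.d n (n + 1)) (by simp)
  have he : e ≫ kernel.ι _ = I.cocomplex.d n (n + 1) := kernel.lift_ι _ _ _
  have hepi : Epi e := by
    rw [epi_iff_surjective_up_to_refinements]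
    intro T y
    obtain ⟨T', π, hπ, x, hx⟩ := hex.exact_up_to_refinements (y ≫ kernel.ι _) (by simp)
    refine ⟨T', π, hπ, x, ?_⟩
    rw [← cancel_mono (kernel.ι _), Category.assoc, Category.assoc, he]
    exact hx
  have hke : k ≫ e = 0 := by
    rw [← cancel_mono (kernel.ι _), Category.assoc, he, w, zero_comp]
  refine ⟨e, hke, he, ShortComplex.ShortExact.mk' ?_ (by dsimp; infer_instance)
    (by dsimp; infer_instance)⟩
  rw [ShortComplex.exact_iff_exact_up_to_refinements] at hk ⊢
  intro T x hx
  dsimp at hx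
  refine hk x ?_
  have := hx =≫ kernel.ι _
  rwa [Category.assoc, he, zero_comp] at this

omit [EnoughInjectives A] in
-- Here `Z` is the object of `n`-cocycles, and `0 → Zⁿ → Iⁿ → Zⁿ⁺¹ → 0` is exact with `Iⁿ` adapted,
-- so the index `j = d - n` drops by one at each step. At `n = d`, exactness of `F I` in degree `d +
-- 1` says that `F I^d → F Z^(d+1)` is epi.
lemma hasAdaptedDimensionLE_of_injectiveResolution {M : A} (I : InjectiveResolution M) (d : ℕ)
    (h : ((F.mapHomologicalComplex _).obj I.cocomplex).ExactAt (d + 1)) (j n : ℕ) (hn : n + j = d)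
    {Z : A} (k : Z ⟶ I.cocomplex.X n) [Mono k] (w : k ≫ I.cocomplex.d n (n + 1) = 0)
    (hk : (ShortComplex.mk _ _ w).Exact) : HasAdaptedDimensionLE F P j Z := by
  induction j generalizing n Z with
  | zero =>
    obtain ⟨e, hke, he, hS⟩ := shortExact_of_injectiveResolution I n k w hk
    obtain rfl : n = d := hn
    refine .of_shortExact hS (hP.preservesEpiOfExtension (hP.injective _)) ?_
    rw [HomologicalComplex.exactAt_iff' _ n (n + 1) (n + 2) (by simp) (by simp)] at h
    exact epi_map_of_exact he (kernel.condition _) h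
  | succ j hj =>
    obtain ⟨e, hke, he, hS⟩ := shortExact_of_injectiveResolution I n k w hk
    exact ⟨_, _, k, e, hke, hS, hP.injective _, hj (n + 1) (by lia) (kernel.ι _)
      (kernel.condition _) (ShortComplex.exact_kernel _)⟩

/-- `M` is the object of `0`-cocycles of an injective resolution `I`, and the derived functor in
degree `d + 1` is the cohomology of `F I` there. -/
lemma hasAdaptedDimensionLE_of_isZero_rightDerived [HasInjectiveResolutions A] (d : ℕ) (M : A)
    (h : IsZero ((F.rightDerived (d + 1)).obj M)) : HasAdaptedDimensionLE F P d M := by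
  let I : InjectiveResolution M := HasInjectiveResolution.out.some
  let k : M ⟶ I.cocomplex.X 0 := I.ι.f 0
  have : Mono k := mono_of_isLimit_fork I.isLimitKernelFork
  refine hP.hasAdaptedDimensionLE_of_injectiveResolution I d ?_ d 0 (by simp) k
    I.ι_f_zero_comp_complex_d (ShortComplex.exact_of_f_is_kernel _ I.isLimitKernelFork)
  rw [HomologicalComplex.exactAt_iff_isZero_homology]
  exact h.of_iso (I.isoRightDerivedObj F (d + 1)).symm

end IsAdaptedClass

end ExtensionVanishing

end CategoryTheory

/-! ### Mapping cones and mapping cocones -/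

namespace CochainComplex

open CategoryTheory Limits HomComplex

section

variable {C : Type*} [Category* C] [Abelian C]

open DerivedCategory in
lemma mappingCone.quasiIso_map {K₁ L₁ K₂ L₂ : CochainComplex C ℤ} (φ₁ : K₁ ⟶ L₁) (φ₂ : K₂ ⟶ L₂)
    (a : K₁ ⟶ K₂) (b : L₁ ⟶ L₂) (comm : φ₁ ≫ b = a ≫ φ₂) [QuasiIso a] [QuasiIso b] :
    QuasiIso (mappingCone.map φ₁ φ₂ a b comm) := by
  let := HasDerivedCategory.standard C
  rw [← isIso_Q_map_iff_quasiIso]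
  exact Pretriangulated.isIso₃_of_isIso₁₂
    (Q.mapTriangle.map (mappingCone.triangleMap φ₁ φ₂ a b comm))
    (mappingCone_triangle_distinguished φ₁) (mappingCone_triangle_distinguished φ₂)
    ((isIso_Q_map_iff_quasiIso _ a).2 inferInstance)
    ((isIso_Q_map_iff_quasiIso _ b).2 inferInstance)

/-- The cone maps quasi-isomorphically to the cone of the identity of `L`, which is contractible. -/
lemma mappingCone.acyclic_of_quasiIso {K L : CochainComplex C ℤ} (φ : K ⟶ L) [QuasiIso φ] :
    (mappingCone φ).Acyclic := by
  have := mappingCone.quasiIso_map φ (𝟙 L) φ (𝟙 L) rfl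
  have h := (mappingCone.homotopyToZeroOfId L)
  intro n
  rw [exactAt_iff_of_quasiIsoAt (mappingCone.map φ (𝟙 L) φ (𝟙 L) rfl) n,
    HomologicalComplex.exactAt_iff_isZero_homology, IsZero.iff_id_eq_zero,
    ← HomologicalComplex.homologyMap_id, h.homologyMap_eq, HomologicalComplex.homologyMap_zero]

lemma mappingCocone.acyclic_of_quasiIso {K L : CochainComplex C ℤ} (φ : K ⟶ L) [QuasiIso φ] :
    (mappingCocone φ).Acyclic := by
  intro n
  rw [HomologicalComplex.exactAt_iff_isZero_homology]
  refine IsZero.of_iso ((HomologicalComplex.exactAt_iff_isZero_homology _ _).1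
    (mappingCone.acyclic_of_quasiIso φ (-1 + n)))
    (((HomologicalComplex.homologyFunctor C (.up ℤ) 0).shiftIso (-1) n (-1 + n) rfl).app
      (mappingCone φ))

variable {K L N M : CochainComplex C ℤ}

lemma mappingCocone.ext_to (φ : K ⟶ L) {n m : ℤ} (h : n + -1 = m) {T : C}
    {x y : T ⟶ (mappingCocone φ).X n} (h₁ : x ≫ (fst φ).f n = y ≫ (fst φ).f n)
    (h₂ : x ≫ (snd φ).v n m h = y ≫ (snd φ).v n m h) : x = y := by
  rw [← Category.comp_id x, ← Category.comp_id y, ← mappingCocone.id_X φ n m h,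
    Preadditive.comp_add, Preadditive.comp_add, reassoc_of% h₁, reassoc_of% h₂]

/-- The functoriality of the mapping cocone. -/
noncomputable def mappingCocone.map {K₁ L₁ K₂ L₂ : CochainComplex C ℤ} (φ₁ : K₁ ⟶ L₁)
    (φ₂ : K₂ ⟶ L₂) (a : K₁ ⟶ K₂) (b : L₁ ⟶ L₂) (comm : φ₁ ≫ b = a ≫ φ₂) :
    mappingCocone φ₁ ⟶ mappingCocone φ₂ := (mappingCone.map φ₁ φ₂ a b comm)⟦(-1 : ℤ)⟧'

/-- The cocone is the cone shifted by `-1`; the sign in the definition of `fst` cancels the sign of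
the left shift. Identities about cocones thus reduce to identities about cones. -/
lemma mappingCocone.fst_f (φ : K ⟶ L) (n : ℤ) :
    (fst φ).f n = (mappingCone.fst φ).1.v (n + -1) n (by lia) := by
  have := Cochain.leftShift_v (mappingCone.fst φ).1 (-1) 0 (add_neg_cancel 1) n n (add_zero n) (n + -1) (by lia)
  dsimp only [fst]
  erw [HomologicalComplex.neg_f_apply, Cocycle.homOf_f]
  erw [this]
  erw [shiftFunctorObjXIso]
  simp
  exact (neg_neg _).trans (Category.id_comp _)

lemma mappingCocone.snd_v (φ : K ⟶ L) (n : ℤ) :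
    (snd φ).v n (n + -1) rfl = (mappingCone.snd φ).v (n + -1) (n + -1) (by lia) := by
  have := Cochain.leftShift_v (mappingCone.snd φ) (-1) (-1) (zero_add _) n (n + -1) rfl (n + -1) (by lia)
  erw [this]
  erw [shiftFunctorObjXIso]
  simp [Int.negOnePow_even 2 ⟨1, rfl⟩]
  exact Category.id_comp _

lemma mappingCocone.map_f_fst_f {K₁ L₁ K₂ L₂ : CochainComplex C ℤ} (φ₁ : K₁ ⟶ L₁)
    (φ₂ : K₂ ⟶ L₂) (a : K₁ ⟶ K₂) (b : L₁ ⟶ L₂) (comm : φ₁ ≫ b = a ≫ φ₂) (n : ℤ) :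
    (mappingCocone.map φ₁ φ₂ a b comm).f n ≫ (fst φ₂).f n = (fst φ₁).f n ≫ a.f n := by
  have : (mappingCone.map φ₁ φ₂ a b comm).f (n + -1) ≫
      (mappingCone.fst φ₂).1.v (n + -1) n (by lia) =
      (mappingCone.fst φ₁).1.v (n + -1) n (by lia) ≫ a.f n := by
    rw [mappingCone.ext_from_iff φ₁ n (n + -1) (by lia)]
    simp [mappingCone.map]
  rw [fst_f, fst_f]
  exact this

lemma mappingCocone.map_f_snd_v {K₁ L₁ K₂ L₂ : CochainComplex C ℤ} (φ₁ : K₁ ⟶ L₁)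
    (φ₂ : K₂ ⟶ L₂) (a : K₁ ⟶ K₂) (b : L₁ ⟶ L₂) (comm : φ₁ ≫ b = a ≫ φ₂) (n m : ℤ)
    (h : n + -1 = m) :
    (mappingCocone.map φ₁ φ₂ a b comm).f n ≫ (snd φ₂).v n m h =
      (snd φ₁).v n m h ≫ b.f m := by
  subst h
  have : (mappingCone.map φ₁ φ₂ a b comm).f (n + -1) ≫
      (mappingCone.snd φ₂).v (n + -1) (n + -1) (by lia) =
      (mappingCone.snd φ₁).v (n + -1) (n + -1) (by lia) ≫ b.f (n + -1) := by
    rw [mappingCone.ext_from_iff φ₁ n (n + -1) (by lia)]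
    simp [mappingCone.map]
  rw [snd_v, snd_v]
  exact this

lemma mappingCocone.map_f_fst_f_assoc {K₁ L₁ K₂ L₂ : CochainComplex C ℤ} (φ₁ : K₁ ⟶ L₁)
    (φ₂ : K₂ ⟶ L₂) (a : K₁ ⟶ K₂) (b : L₁ ⟶ L₂) (comm : φ₁ ≫ b = a ≫ φ₂) (n : ℤ) {Z : C}
    (z : K₂.X n ⟶ Z) : (mappingCocone.map φ₁ φ₂ a b comm).f n ≫ (fst φ₂).f n ≫ z =
      (fst φ₁).f n ≫ a.f n ≫ z := by
  rw [← Category.assoc, map_f_fst_f, Category.assoc]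

lemma mappingCocone.map_f_snd_v_assoc {K₁ L₁ K₂ L₂ : CochainComplex C ℤ} (φ₁ : K₁ ⟶ L₁)
    (φ₂ : K₂ ⟶ L₂) (a : K₁ ⟶ K₂) (b : L₁ ⟶ L₂) (comm : φ₁ ≫ b = a ≫ φ₂) (n m : ℤ)
    (h : n + -1 = m) {Z : C} (z : L₂.X m ⟶ Z) :
    (mappingCocone.map φ₁ φ₂ a b comm).f n ≫ (snd φ₂).v n m h ≫ z =
      (snd φ₁).v n m h ≫ b.f m ≫ z := by
  rw [← Category.assoc, map_f_snd_v, Category.assoc]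

attribute [simp] mappingCocone.map_f_fst_f mappingCocone.map_f_snd_v
  mappingCocone.map_f_fst_f_assoc mappingCocone.map_f_snd_v_assoc

lemma mappingCocone.inl_v_map_f {K₁ L₁ K₂ L₂ : CochainComplex C ℤ} (φ₁ : K₁ ⟶ L₁)
    (φ₂ : K₂ ⟶ L₂) (a : K₁ ⟶ K₂) (b : L₁ ⟶ L₂) (comm : φ₁ ≫ b = a ≫ φ₂) (n : ℤ) :
    (inl φ₁).v n n (add_zero n) ≫ (mappingCocone.map φ₁ φ₂ a b comm).f n =
      a.f n ≫ (inl φ₂).v n n (add_zero n) :=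
  mappingCocone.ext_to φ₂ rfl (by simp) (by simp)

lemma mappingCocone.inr_v_map_f {K₁ L₁ K₂ L₂ : CochainComplex C ℤ} (φ₁ : K₁ ⟶ L₁)
    (φ₂ : K₂ ⟶ L₂) (a : K₁ ⟶ K₂) (b : L₁ ⟶ L₂) (comm : φ₁ ≫ b = a ≫ φ₂) (m n : ℤ)
    (h : m + 1 = n) :
    (inr φ₁).1.v m n h ≫ (mappingCocone.map φ₁ φ₂ a b comm).f n =
      b.f m ≫ (inr φ₂).1.v m n h :=
  mappingCocone.ext_to φ₂ (m := m) (by lia) (by simp) (by simp)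

lemma mappingCocone.quasiIso_map {K₁ L₁ K₂ L₂ : CochainComplex C ℤ} (φ₁ : K₁ ⟶ L₁)
    (φ₂ : K₂ ⟶ L₂) (a : K₁ ⟶ K₂) (b : L₁ ⟶ L₂) (comm : φ₁ ≫ b = a ≫ φ₂) [QuasiIso a]
    [QuasiIso b] : QuasiIso (mappingCocone.map φ₁ φ₂ a b comm) := by
  have := mappingCone.quasiIso_map φ₁ φ₂ a b comm
  exact (quasiIso_shift_iff _ _).2 this

lemma mono_iff_forall_f {K L : CochainComplex C ℤ} (φ : K ⟶ L) : Mono φ ↔ ∀ n, Mono (φ.f n) :=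
  ⟨fun _ _ ↦ inferInstance, fun _ ↦ HomologicalComplex.mono_of_mono_f φ inferInstance⟩

lemma mappingCocone.mono_map {K₁ L₁ K₂ L₂ : CochainComplex C ℤ} (φ₁ : K₁ ⟶ L₁)
    (φ₂ : K₂ ⟶ L₂) (a : K₁ ⟶ K₂) (b : L₁ ⟶ L₂) (comm : φ₁ ≫ b = a ≫ φ₂) [Mono a] [Mono b] :
    Mono (mappingCocone.map φ₁ φ₂ a b comm) := by
  rw [mono_iff_forall_f]
  refine fun n ↦ ⟨fun {T} x y h ↦ mappingCocone.ext_to φ₁ rfl ?_ ?_⟩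
  · rw [← cancel_mono (a.f n)]
    simpa using h =≫ (fst φ₂).f n
  · rw [← cancel_mono (b.f _)]
    simpa using h =≫ (snd φ₂).v n _ rfl

/-- The functor which sends an object `X` to the mapping cocone of `τ.app X`, where `τ` is a
natural transformation between functors to the category of cochain complexes. -/
noncomputable def mappingCoconeFunctor {D : Type*} [Category* D] {Φ Ψ : D ⥤ CochainComplex C ℤ}
    (τ : Φ ⟶ Ψ) : D ⥤ CochainComplex C ℤ where
  obj X := mappingCocone (τ.app X)
  map f := mappingCocone.map _ _ (Φ.map f) (Ψ.map f) (by simp)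
  map_id X := by
    ext n
    exact mappingCocone.ext_to _ rfl (by simp) (by simp)
  map_comp f g := by
    ext n
    exact mappingCocone.ext_to _ rfl (by simp) (by simp)

/-- Given a degreewise short exact sequence `0 ⟶ K ⟶ L ⟶ M ⟶ 0` and a quasi-isomorphism
`M ⟶ N`, the complex `K` is quasi-isomorphic to the mapping cocone of `L ⟶ N`. -/
lemma mappingCocone.quasiIso_lift {K L M N : CochainComplex C ℤ} (i : K ⟶ L) (g : L ⟶ M)
    (w : i ≫ g = 0) (γ : M ⟶ N) [QuasiIso γ]
    (h : ∀ n, (ShortComplex.mk (i.f n) (g.f n) (by simp [← HomologicalComplex.comp_f, w])).ShortExact) :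
    QuasiIso (mappingCocone.lift (g ≫ γ) i 0 (by simp [reassoc_of% w])) := by
  -- The comparison map `j` is the kernel of `p` in a degreewise short exact sequence whose last
  -- term, the cocone of `γ`, is acyclic; the long exact sequence then makes `j` a
  -- quasi-isomorphism.
  let p : mappingCocone (g ≫ γ) ⟶ mappingCocone γ := mappingCocone.map _ _ g (𝟙 N) (by simp)
  let j := mappingCocone.lift (g ≫ γ) i 0 (by simp [reassoc_of% w])
  have wjp : j ≫ p = 0 := by
    ext n
    refine mappingCocone.ext_to _ rfl ?_ ?_
    · simp only [p, j, HomologicalComplex.comp_f, Category.assoc, map_f_fst_f, lift_f_fst_f_assoc]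
      simp [← HomologicalComplex.comp_f, w]
    · simp [p, j]
  have hS : (ShortComplex.mk j p wjp).ShortExact := by
    refine HomologicalComplex.shortExact_of_degreewise_shortExact _ (fun n ↦ ?_)
    have hi : Mono (i.f n) := (h n).mono_f
    have hg : Epi (g.f n) := (h n).epi_g
    have hj : Mono (j.f n) := by
      have : Mono (j.f n ≫ (fst (g ≫ γ)).f n) := by simpa [j]
      exact mono_of_mono _ ((fst (g ≫ γ)).f n)
    have hp : Epi (p.f n) := by
      rw [epi_iff_surjective_up_to_refinements]
      intro T y
      obtain ⟨T', π, _, x, hx⟩ := surjective_up_to_refinements_of_epi (g.f n)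
        (y ≫ (fst γ).f n)
      refine ⟨T', π, inferInstance, x ≫ (inl (g ≫ γ)).v n n (add_zero n) +
        π ≫ y ≫ (snd γ).v n (n + -1) rfl ≫ (inr (g ≫ γ)).1.v (n + -1) n (by lia), ?_⟩
      refine mappingCocone.ext_to _ rfl ?_ ?_
      · simp [p, hx]
      · simp [p]
    refine ShortComplex.ShortExact.mk' ?_ hj hp
    rw [ShortComplex.exact_iff_exact_up_to_refinements]
    intro T (x : T ⟶ (mappingCocone (g ≫ γ)).X n) (hx : x ≫ p.f n = 0)
    have h1 : (x ≫ (fst (g ≫ γ)).f n) ≫ g.f n = 0 := by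
      simpa [p] using hx =≫ (fst γ).f n
    have h2 : x ≫ (snd (g ≫ γ)).v n _ rfl = 0 := by
      simpa [p] using hx =≫ (snd γ).v n _ rfl
    refine ⟨T, 𝟙 T, inferInstance, (h n).exact.lift _ h1, ?_⟩
    have h3 : (h n).exact.lift _ h1 ≫ i.f n = _ := (h n).exact.lift_f _ h1
    refine (Category.id_comp x).trans (mappingCocone.ext_to (g ≫ γ) rfl (x := x)
      (y := (h n).exact.lift _ h1 ≫ j.f n) ?_ ?_)
    · simp [j, h3]
    · simp [j, h2]
  have hac := mappingCocone.acyclic_of_quasiIso γ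
  change QuasiIso j
  rw [quasiIso_iff]
  intro n
  rw [quasiIsoAt_iff_isIso_homologyMap]
  have hz (m : ℤ) : IsZero ((mappingCocone γ).homology m) :=
    (HomologicalComplex.exactAt_iff_isZero_homology _ _).1 (hac m)
  have h1 := hS.homology_exact₂ n
  have h2 := hS.homology_exact₁ (n - 1) n (by simp)
  have : Mono (HomologicalComplex.homologyMap j n) :=
    h2.mono_g ((hz _).eq_of_src _ _)
  have : Epi (HomologicalComplex.homologyMap j n) :=
    h1.epi_f ((hz _).eq_of_tgt _ _)
  exact isIso_of_mono_of_epi _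

end

end CochainComplex

/-! ### Cocontinuous exact functors on complexes -/

namespace CategoryTheory

open Limits

section

variable {D E : Type*} [Category* D] [Category* E] [Preadditive E]

/-- A functor which decomposes as a direct sum of two functors preserving colimits of
shape `J` also preserves colimits of shape `J`. -/
lemma preservesColimitsOfShape_of_bicone {G G₁ G₂ : D ⥤ E} (i₁ : G₁ ⟶ G) (p₁ : G ⟶ G₁)
    (i₂ : G₂ ⟶ G) (p₂ : G ⟶ G₂)
    (h : ∀ X, p₁.app X ≫ i₁.app X + p₂.app X ≫ i₂.app X = 𝟙 _)
    (J : Type*) [Category* J] [PreservesColimitsOfShape J G₁] [PreservesColimitsOfShape J G₂] :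
    PreservesColimitsOfShape J G where
  preservesColimit {K} := ⟨fun {c} hc ↦ ⟨by
    have hc₁ := isColimitOfPreserves G₁ hc
    have hc₂ := isColimitOfPreserves G₂ hc
    let s₁ (s : Cocone (K ⋙ G)) : Cocone (K ⋙ G₁) :=
      (Cocone.precompose (Functor.whiskerLeft K i₁)).obj s
    let s₂ (s : Cocone (K ⋙ G)) : Cocone (K ⋙ G₂) :=
      (Cocone.precompose (Functor.whiskerLeft K i₂)).obj s
    have f₁ (s j) : G₁.map (c.ι.app j) ≫ hc₁.desc (s₁ s) = i₁.app _ ≫ s.ι.app j :=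
      hc₁.fac (s₁ s) j
    have f₂ (s j) : G₂.map (c.ι.app j) ≫ hc₂.desc (s₂ s) = i₂.app _ ≫ s.ι.app j :=
      hc₂.fac (s₂ s) j
    exact
      { desc s := (p₁.app _ ≫ hc₁.desc (s₁ s) : _ ⟶ s.pt) + (p₂.app _ ≫ hc₂.desc (s₂ s) : _ ⟶ s.pt)
        fac s j := by
          dsimp
          rw [Preadditive.comp_add, p₁.naturality_assoc, p₂.naturality_assoc, f₁, f₂,
            ← Category.assoc, ← Category.assoc, ← Preadditive.add_comp, h, Category.id_comp]
        uniq s m hm := by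
          have hm' (j) : G.map (c.ι.app j) ≫ m = s.ι.app j := hm j
          have e₁ : hc₁.desc (s₁ s) = i₁.app _ ≫ m := hc₁.hom_ext fun j ↦ by
            rw [hc₁.fac]
            dsimp [s₁]
            rw [i₁.naturality_assoc, hm']
          have e₂ : hc₂.desc (s₂ s) = i₂.app _ ≫ m := hc₂.hom_ext fun j ↦ by
            rw [hc₂.fac]
            dsimp [s₂]
            rw [i₂.naturality_assoc, hm']
          dsimp
          rw [e₁, e₂, ← Category.assoc, ← Category.assoc, ← Preadditive.add_comp, h,
            Category.id_comp] }⟩⟩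

end

end CategoryTheory

namespace CochainComplex

open CategoryTheory Limits HomComplex

variable {C : Type*} [Category* C] [Abelian C]

/-- Colimits of complexes are computed degreewise, and in degree `n` the cocone is naturally the
direct sum of `Φ` in degree `n` and `Ψ` in degree `n - 1`. -/
lemma preservesColimitsOfShape_mappingCoconeFunctor {D : Type*} [Category* D]
    {Φ Ψ : D ⥤ CochainComplex C ℤ} (τ : Φ ⟶ Ψ) (J : Type*) [Category* J]
    [PreservesColimitsOfShape J Φ] [PreservesColimitsOfShape J Ψ] [HasColimitsOfShape J C] :
    PreservesColimitsOfShape J (mappingCoconeFunctor τ) :=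
  HomologicalComplex.preservesColimitsOfShape_of_eval _ fun n ↦ by
    let p₁ : mappingCoconeFunctor τ ⋙ HomologicalComplex.eval _ _ n ⟶
        Φ ⋙ HomologicalComplex.eval _ _ n :=
      { app X := (mappingCocone.fst (τ.app X)).f n
        naturality _ _ _ := mappingCocone.map_f_fst_f _ _ _ _ (by simp) _ }
    let p₂ : mappingCoconeFunctor τ ⋙ HomologicalComplex.eval _ _ n ⟶
        Ψ ⋙ HomologicalComplex.eval _ _ (n + -1) :=
      { app X := (mappingCocone.snd (τ.app X)).v n (n + -1) rfl
        naturality _ _ _ := mappingCocone.map_f_snd_v _ _ _ _ (by simp) _ _ _ }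
    let i₁ : Φ ⋙ HomologicalComplex.eval _ _ n ⟶
        mappingCoconeFunctor τ ⋙ HomologicalComplex.eval _ _ n :=
      { app X := (mappingCocone.inl (τ.app X)).v n n (add_zero n)
        naturality _ _ _ := (mappingCocone.inl_v_map_f _ _ _ _ (by simp) _).symm }
    let i₂ : Ψ ⋙ HomologicalComplex.eval _ _ (n + -1) ⟶
        mappingCoconeFunctor τ ⋙ HomologicalComplex.eval _ _ n :=
      { app X := (mappingCocone.inr (τ.app X)).1.v (n + -1) n (by lia)
        naturality _ _ _ := (mappingCocone.inr_v_map_f _ _ _ _ (by simp) _ _ _).symm }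
    exact preservesColimitsOfShape_of_bicone i₁ p₁ i₂ p₂
      (fun X ↦ mappingCocone.id_X (τ.app X) n (n + -1) rfl) J

lemma isZero_mappingCocone_X {K L : CochainComplex C ℤ} (φ : K ⟶ L) (n : ℤ) (hK : IsZero (K.X n))
    (hL : IsZero (L.X (n + -1))) : IsZero ((mappingCocone φ).X n) := by
  rw [IsZero.iff_id_eq_zero]
  exact mappingCocone.ext_to φ rfl (hK.eq_of_tgt _ _) (hL.eq_of_tgt _ _)

universe v

variable {A B : Type*} [Category.{v} A] [Category.{v} B] [Abelian A] [Abelian B]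

/-- Functors between categories of cochain complexes which preserve colimits, monomorphisms,
quasi-isomorphisms and bounds. -/
structure IsCocontinuousExact (Φ : CochainComplex A ℤ ⥤ CochainComplex B ℤ) : Prop where
  preservesColimits : PreservesColimits Φ
  mono_map {K L : CochainComplex A ℤ} (φ : K ⟶ L) (_ : Mono φ) : Mono (Φ.map φ)
  quasiIso_map {K L : CochainComplex A ℤ} (φ : K ⟶ L) (_ : QuasiIso φ) : QuasiIso (Φ.map φ)
  isStrictlyGE (K : CochainComplex A ℤ) (n : ℤ) (_ : K.IsStrictlyGE n) :
    (Φ.obj K).IsStrictlyGE n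
  exists_isStrictlyLE : ∃ r : ℤ, ∀ (K : CochainComplex A ℤ) (n : ℤ), K.IsStrictlyLE n →
    (Φ.obj K).IsStrictlyLE (n + r)

lemma isCocontinuousExact_mapHomologicalComplex [HasColimits A] (G : A ⥤ B) [G.Additive]
    [PreservesFiniteLimits G] [PreservesColimits G] :
    IsCocontinuousExact (G.mapHomologicalComplex (ComplexShape.up ℤ)) where
  preservesColimits := ⟨inferInstance⟩
  mono_map φ _ := (mono_iff_forall_f _).2 fun n ↦ inferInstanceAs (Mono (G.map (φ.f n)))
  quasiIso_map φ _ := inferInstance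
  isStrictlyGE K n _ := by
    rw [isStrictlyGE_iff]
    exact fun i hi ↦ G.map_isZero (K.isZero_of_isStrictlyGE n i)
  exists_isStrictlyLE := ⟨0, fun K n _ ↦ by
    rw [isStrictlyLE_iff]
    exact fun i hi ↦ G.map_isZero (K.isZero_of_isStrictlyLE n i)⟩

lemma IsCocontinuousExact.mappingCoconeFunctor [HasColimits B]
    {Φ Ψ : CochainComplex A ℤ ⥤ CochainComplex B ℤ}
    (hΦ : IsCocontinuousExact Φ) (hΨ : IsCocontinuousExact Ψ) (τ : Φ ⟶ Ψ) :
    IsCocontinuousExact (mappingCoconeFunctor τ) where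
  preservesColimits := by
    have := hΦ.preservesColimits
    have := hΨ.preservesColimits
    exact ⟨fun {J} ↦ preservesColimitsOfShape_mappingCoconeFunctor τ J⟩
  mono_map φ _ := by
    have := hΦ.mono_map φ inferInstance
    have := hΨ.mono_map φ inferInstance
    exact mappingCocone.mono_map _ _ _ _ _
  quasiIso_map φ _ := by
    have := hΦ.quasiIso_map φ inferInstance
    have := hΨ.quasiIso_map φ inferInstance
    exact mappingCocone.quasiIso_map _ _ _ _ _
  isStrictlyGE K n _ := by
    have := hΦ.isStrictlyGE K n inferInstance
    have := hΨ.isStrictlyGE K n inferInstance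
    rw [isStrictlyGE_iff]
    exact fun i hi ↦ isZero_mappingCocone_X _ _ (isZero_of_isStrictlyGE _ n _)
      (isZero_of_isStrictlyGE _ n _)
  exists_isStrictlyLE := by
    obtain ⟨r, hr⟩ := hΦ.exists_isStrictlyLE
    obtain ⟨s, hs⟩ := hΨ.exists_isStrictlyLE
    -- The summand coming from `Ψ` sits one degree higher in the cocone.
    refine ⟨max r (s + 1), fun K n _ ↦ ?_⟩
    have := hr K n inferInstance
    have := hs K n inferInstance
    rw [isStrictlyLE_iff]
    exact fun i hi ↦ isZero_mappingCocone_X _ _ (isZero_of_isStrictlyLE _ (n + r) _)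
      (isZero_of_isStrictlyLE _ (n + s) _)

end CochainComplex

/-! ### Functorial short exact sequences and their cokernel functors -/

namespace CategoryTheory

open Limits

section

variable {A : Type*} [Category* A] [Abelian A]

lemma exact_mk_iff {X Y Z : A} (f : X ⟶ Y) (g : Y ⟶ Z) (w : f ≫ g = 0) :
    (ShortComplex.mk f g w).Exact ↔ ∀ ⦃T : A⦄ (x : T ⟶ Y) (_ : x ≫ g = 0),
      ∃ (T' : A) (π : T' ⟶ T) (_ : Epi π) (x' : T' ⟶ X), π ≫ x = x' ≫ f :=
  ShortComplex.exact_iff_exact_up_to_refinements _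

/-- Functorial short exact sequences `0 ⟶ M ⟶ T M ⟶ Q M ⟶ 0`. -/
structure FunctorialShortExact (T : A ⥤ A) where
  /-- the cokernel functor -/
  Q : A ⥤ A
  /-- the inclusion -/
  η (M : A) : M ⟶ T.obj M
  /-- the projection -/
  π : T ⟶ Q
  naturality {M N : A} (f : M ⟶ N) : η M ≫ T.map f = f ≫ η N
  w (M : A) : η M ≫ π.app M = 0
  shortExact (M : A) : (ShortComplex.mk (η M) (π.app M) (w M)).ShortExact

/-- The functorial short exact sequence attached to a monomorphic natural
transformation `𝟭 ⟶ T`. -/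
noncomputable def FunctorialShortExact.ofMono {T : A ⥤ A} (η : 𝟭 A ⟶ T) [∀ M, Mono (η.app M)] :
    FunctorialShortExact T where
  Q :=
    { obj M := cokernel (η.app M)
      map f := cokernel.map _ _ f (T.map f) (η.naturality f).symm }
  η M := η.app M
  π := { app M := cokernel.π (η.app M)
         naturality _ _ _ := (cokernel.π_desc _ _ _).symm }
  naturality f := (η.naturality f).symm
  w M := cokernel.condition _
  shortExact M := ShortComplex.ShortExact.mk' (ShortComplex.exact_cokernel _)
    (inferInstance : Mono (η.app M)) (inferInstance : Epi (cokernel.π (η.app M)))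

namespace FunctorialShortExact

variable {T : A ⥤ A} (E : FunctorialShortExact T)

lemma naturality_assoc {M N Z : A} (f : M ⟶ N) (z : T.obj N ⟶ Z) :
    E.η M ≫ T.map f ≫ z = f ≫ E.η N ≫ z := by
  rw [← Category.assoc, E.naturality, Category.assoc]

lemma w_assoc (M : A) {Z : A} (z : E.Q.obj M ⟶ Z) : E.η M ≫ E.π.app M ≫ z = 0 := by
  rw [← Category.assoc, E.w, zero_comp]

instance (M : A) : Epi (E.π.app M) := (E.shortExact M).epi_g

instance (M : A) : Mono (E.η M) := (E.shortExact M).mono_f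

lemma additive_Q [T.Additive] : E.Q.Additive where
  map_add {X Y f g} := by
    rw [← cancel_epi (E.π.app X), ← E.π.naturality, T.map_add, Preadditive.add_comp,
      Preadditive.comp_add, E.π.naturality, E.π.naturality]

/-- `Q` is the cokernel of a natural transformation between two functors preserving these colimits,
and colimits commute with cokernels. -/
lemma preservesColimitsOfShape_Q (J : Type*) [Category* J] [PreservesColimitsOfShape J T] :
    PreservesColimitsOfShape J E.Q where
  preservesColimit {K} := ⟨fun {c} hc ↦ ⟨by
    have hT := isColimitOfPreserves T hc
    let t (s : Cocone (K ⋙ E.Q)) : Cocone (K ⋙ T) :=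
      (Cocone.precompose (Functor.whiskerLeft K E.π)).obj s
    have ht (s j) : T.map (c.ι.app j) ≫ hT.desc (t s) = E.π.app _ ≫ s.ι.app j := hT.fac (t s) j
    have hη (s) : E.η c.pt ≫ hT.desc (t s) = 0 := hc.hom_ext fun j ↦ by
      have : c.ι.app j ≫ E.η c.pt ≫ hT.desc (t s) =
        E.η _ ≫ T.map (c.ι.app j) ≫ hT.desc (t s) := (E.naturality_assoc (c.ι.app j) _).symm
      rw [this, ht, w_assoc]
      exact comp_zero.symm
    have hex (s) : ∃ d : E.Q.obj c.pt ⟶ s.pt, E.π.app _ ≫ d = hT.desc (t s) :=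
      ⟨(E.shortExact c.pt).exact.desc _ (hη s), (E.shortExact c.pt).exact.g_desc _ _⟩
    choose d hd using hex
    exact
      { desc s := d s
        fac s j := by
          change E.Q.map (c.ι.app j) ≫ d s = _
          have := hd s
          rw [← cancel_epi (E.π.app (K.obj j)), ← ht, ← this]
          exact (E.π.naturality_assoc (c.ι.app j) (d s)).symm
        uniq s m hm := by
          have hm' (j) : E.Q.map (c.ι.app j) ≫ m = s.ι.app j := hm j
          change E.Q.obj c.pt ⟶ s.pt at m
          have : E.π.app c.pt ≫ m = hT.desc (t s) := hT.hom_ext fun j ↦ by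
            rw [hT.fac]
            dsimp [t]
            rw [E.π.naturality_assoc, hm']
          rw [← cancel_epi (E.π.app c.pt), this, hd] }⟩⟩

/-- This is the nine lemma: the rows of the identity functor and of `T` are short exact, hence so is
the row of cokernels. -/
lemma shortExact_map_Q [T.Additive]
    [PreservesFiniteLimits T] [PreservesFiniteColimits T] {X Y Z : A} (f : X ⟶ Y) (g : Y ⟶ Z)
    (w : f ≫ g = 0) (hS : (ShortComplex.mk f g w).ShortExact) (w' : E.Q.map f ≫ E.Q.map g = 0) :
    (ShortComplex.mk (E.Q.map f) (E.Q.map g) w').ShortExact := by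
  have hf : Mono f := hS.mono_f
  have hg : Epi g := hS.epi_g
  have hex := (exact_mk_iff _ _ _).1 hS.exact
  have hT := (exact_mk_iff (T.map f) (T.map g) (by rw [← T.map_comp, w, T.map_zero])).1
    (hS.map_of_exact T).exact
  have hπ (M : A) := (exact_mk_iff _ _ _).1 (E.shortExact M).exact
  refine ShortComplex.ShortExact.mk' ?_ ?_ ?_
  · rw [exact_mk_iff]
    intro Z x hx
    obtain ⟨Z₁, p₁, _, t, ht⟩ := surjective_up_to_refinements_of_epi (E.π.app Y) x
    obtain ⟨Z₂, p₂, _, k, hk⟩ := hπ _ (t ≫ T.map g) (by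
      rw [Category.assoc, E.π.naturality, ← reassoc_of% ht, hx, comp_zero])
    obtain ⟨Z₃, p₃, _, n, hn⟩ := surjective_up_to_refinements_of_epi g k
    -- The lift `t` of `x` to `T Y` goes in `T Z` to an element of `Z`, which lifts to `n` in `Y`.
    -- Correcting `t` by `n` does not affect `x` and puts it in the kernel of `T.map g`.
    obtain ⟨Z₄, p₄, _, m, hm⟩ := hT (p₃ ≫ p₂ ≫ t - n ≫ E.η _) (by
        rw [Preadditive.sub_comp, Category.assoc, Category.assoc, hk, Category.assoc,
          E.naturality, reassoc_of% hn, sub_self])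
    refine ⟨Z₄, p₄ ≫ p₃ ≫ p₂ ≫ p₁, inferInstance, m ≫ E.π.app _, ?_⟩
    have := hm =≫ E.π.app Y
    simp only [Category.assoc, Preadditive.sub_comp, E.w, comp_zero, sub_zero,
      E.π.naturality] at this
    simp only [Category.assoc, ht, this]
  · refine Preadditive.mono_of_cancel_zero (E.Q.map f) fun {Z} x hx ↦ ?_
    obtain ⟨Z₁, p₁, _, t, ht⟩ := surjective_up_to_refinements_of_epi (E.π.app X) x
    obtain ⟨Z₂, p₂, _, k, hk⟩ := hπ _ (t ≫ T.map f) (by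
      rw [Category.assoc, E.π.naturality, ← reassoc_of% ht, hx, comp_zero])
    have hk0 : k ≫ g = 0 := by
      rw [← cancel_mono (E.η _), Category.assoc, ← E.naturality, ← reassoc_of% hk, ← T.map_comp,
        w, T.map_zero, comp_zero, comp_zero, zero_comp]
    obtain ⟨Z₃, p₃, _, n, hn⟩ := hex k hk0
    have : p₃ ≫ p₂ ≫ t = n ≫ E.η _ := by
      rw [← cancel_mono (T.map f), Category.assoc, Category.assoc, hk, Category.assoc,
        E.naturality, reassoc_of% hn]
    rw [← cancel_epi p₁, ← cancel_epi p₂, ← cancel_epi p₃, ht, reassoc_of% this]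
    simp only [E.w, comp_zero]
  · have : Epi (E.π.app Y ≫ E.Q.map g) := by
      rw [← E.π.naturality]
      have : Epi (T.map g) := (hS.map_of_exact T).epi_g
      infer_instance
    exact epi_of_epi (E.π.app Y) _

lemma preservesFiniteLimits_and_preservesFiniteColimits_Q [T.Additive]
    [PreservesFiniteLimits T] [PreservesFiniteColimits T] :
    PreservesFiniteLimits E.Q ∧ PreservesFiniteColimits E.Q := by
  have := E.additive_Q
  exact (E.Q.exact_tfae.out 0 3).1 fun (S : ShortComplex A) hS ↦
    E.shortExact_map_Q S.f S.g S.zero hS (S.map E.Q).zero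

end FunctorialShortExact

end

end CategoryTheory

/-! ### The cocontinuous exact replacement of a left exact functor -/

namespace CochainComplex.mappingCocone

variable {C : Type*} [Category* C] [Abelian C] {K₁ L₁ K₂ L₂ : CochainComplex C ℤ}

open HomComplex

lemma comp_lift_zero {M₁ M₂ : CochainComplex C ℤ} (φ₁ : K₁ ⟶ L₁) (φ₂ : K₂ ⟶ L₂)
    (a : K₁ ⟶ K₂) (b : L₁ ⟶ L₂) (comm : φ₁ ≫ b = a ≫ φ₂) (i₁ : M₁ ⟶ K₁) (i₂ : M₂ ⟶ K₂)
    (f : M₁ ⟶ M₂) (h : i₁ ≫ a = f ≫ i₂)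
    (h₁ : δ (-1) 0 (0 : Cochain M₁ L₁ (-1)) + Cochain.ofHom (i₁ ≫ φ₁) = 0)
    (h₂ : δ (-1) 0 (0 : Cochain M₂ L₂ (-1)) + Cochain.ofHom (i₂ ≫ φ₂) = 0) :
    f ≫ lift φ₂ i₂ 0 h₂ = lift φ₁ i₁ 0 h₁ ≫ map φ₁ φ₂ a b comm := by
  ext n
  refine ext_to φ₂ rfl ?_ ?_
  · have := HomologicalComplex.congr_hom h n
    simp only [HomologicalComplex.comp_f] at this
    simp [this]
  · simp

end CochainComplex.mappingCocone

namespace CategoryTheory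

open Limits

universe v

section

variable {A B : Type*} [Category.{v} A] [Category.{v} B] [Abelian A] [Abelian B]

/-- A left exact functor which preserves coproducts and the epimorphisms in short exact sequences
is exact and preserves colimits. -/
lemma preservesColimits_of_shortExact (G : A ⥤ B) [G.Additive] [HasColimits A]
    [PreservesFiniteLimits G] [∀ J : Type v, PreservesColimitsOfShape (Discrete J) G]
    (hG : ∀ (S : ShortComplex A), S.ShortExact → Epi (G.map S.g)) : PreservesColimits G := by
  obtain ⟨_, _⟩ : PreservesFiniteLimits G ∧ PreservesFiniteColimits G :=
    (G.exact_tfae.out 0 3).1 fun (S : ShortComplex A) (hS : S.ShortExact) ↦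
      have := hS.mono_f
      ShortComplex.ShortExact.mk' (hS.exact.map_of_mono_of_preservesKernel G inferInstance
        inferInstance) (inferInstance : Mono (G.map S.f)) (hG S hS)
  exact preservesColimits_of_preservesCoequalizers_and_coproducts G

variable {F : A ⥤ B} [F.Additive] [PreservesFiniteLimits F] {P : ObjectProperty A}
  (hP : IsAdaptedClass F P)
  {T : A ⥤ A} (E : FunctorialShortExact T) (hT : ∀ M, P (T.obj M))

include hP hT E in
/-- If the objects `H M` are of bounded dimension with respect to a class adapted to `F`, the functor
`H ⋙ F` on complexes extends to a cocontinuous exact functor on complexes, without changing the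
values on the complexes `K` such that the objects `H Kⁱ` are adapted, up to a
quasi-isomorphism. -/
theorem exists_isCocontinuousExact [T.Additive] [PreservesFiniteLimits T] [PreservesColimits T]
    [HasColimits A] [HasColimits B] [EnoughInjectives A]
    [∀ J : Type v, PreservesColimitsOfShape (Discrete J) F]
    (n : ℕ) (H : A ⥤ A) [H.Additive] [PreservesFiniteLimits H] [PreservesColimits H]
    (hH : ∀ M, HasAdaptedDimensionLE F P n (H.obj M)) :
    ∃ (Φ : CochainComplex A ℤ ⥤ CochainComplex B ℤ)
      (α : (H ⋙ F).mapHomologicalComplex (ComplexShape.up ℤ) ⟶ Φ),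
      CochainComplex.IsCocontinuousExact Φ ∧
        ∀ K : CochainComplex A ℤ, (∀ i, P (H.obj (K.X i))) → QuasiIso (α.app K) := by
  have : PreservesFiniteColimits T := PreservesColimitsOfSize.preservesFiniteColimits T
  induction n generalizing H with
  | zero =>
    have : PreservesFiniteColimits H := PreservesColimitsOfSize.preservesFiniteColimits H
    -- In dimension zero the first derived functor of `F` vanishes on every `H M`, so `H ⋙ F` is
    -- already exact and no correction is needed.
    have : PreservesColimits (H ⋙ F) := preservesColimits_of_shortExact _ fun S hS ↦
      hH S.X₁ (H.map S.f) (H.map S.g) _ (hS.map_of_exact H)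
    exact ⟨_, 𝟙 _, CochainComplex.isCocontinuousExact_mapHomologicalComplex _,
      fun K _ ↦ by rw [NatTrans.id_app]; infer_instance⟩
  | succ n ih =>
    have : PreservesFiniteColimits H := PreservesColimitsOfSize.preservesFiniteColimits H
    have := E.additive_Q
    have := E.preservesFiniteLimits_and_preservesFiniteColimits_Q.1
    have : PreservesColimits E.Q := ⟨fun {J} ↦ E.preservesColimitsOfShape_Q J⟩
    -- The induction varies `H`: replacing `H M` by the cokernel of `H M → T (H M)` lowers the
    -- dimension by one.
    obtain ⟨Φ, α, hΦ, hα⟩ := ih (H ⋙ E.Q) fun M ↦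
      hP.hasAdaptedDimensionLE_of_succ (E.shortExact (H.obj M)) (hT _) (hH M)
    have : PreservesColimits (H ⋙ T ⋙ F) := preservesColimits_of_shortExact _ fun S hS ↦
      hP.epi_map _ (hS.map_of_exact (H ⋙ T)) (hT _)
    let i : H ⋙ F ⟶ H ⋙ T ⋙ F :=
      { app M := F.map (E.η (H.obj M))
        naturality M N f := by
          dsimp
          rw [← F.map_comp, ← F.map_comp, E.naturality] }
    let g : H ⋙ T ⋙ F ⟶ (H ⋙ E.Q) ⋙ F :=
      { app M := F.map (E.π.app (H.obj M))
        naturality M N f := by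
          dsimp
          rw [← F.map_comp, ← F.map_comp, E.π.naturality] }
    have hig (M) : i.app M ≫ g.app M = 0 := by
      dsimp [i, g]
      rw [← F.map_comp, E.w, F.map_zero]
    let i' := NatTrans.mapHomologicalComplex i (ComplexShape.up ℤ)
    let g' := NatTrans.mapHomologicalComplex g (ComplexShape.up ℤ)
    have hig' (K) : i'.app K ≫ g'.app K = 0 := by
      ext j
      exact hig _
    -- `F H` is approximated by the cocone of `F T H → F Q H → Φ`, where `Φ` already approximates `F
    -- Q H`. The comparison map exists because the composite `F H → F T H → F Q H` vanishes.
    refine ⟨CochainComplex.mappingCoconeFunctor (g' ≫ α),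
      { app K := CochainComplex.mappingCocone.lift (g'.app K ≫ α.app K) (i'.app K) 0
          (by simp [reassoc_of% hig'])
        naturality K L f := ?_ },
      (CochainComplex.isCocontinuousExact_mapHomologicalComplex _).mappingCoconeFunctor hΦ _,
      fun K hK ↦ ?_⟩
    · exact CochainComplex.mappingCocone.comp_lift_zero _ _ _ _ _ _ _ _ (i'.naturality f).symm _ _
    -- If the `H Kⁱ` are adapted, so are their cokernels in `T (H Kⁱ)`, so the inductive comparison
    -- applies; moreover `F` keeps the sequences short exact.
    · have : QuasiIso (α.app K) := hα K fun j ↦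
        hP.quotient _ (E.shortExact (H.obj (K.X j))) (hK j) (hT _)
      exact CochainComplex.mappingCocone.quasiIso_lift (i'.app K) (g'.app K) (hig' K) (α.app K)
        fun j ↦ by
          have hS := E.shortExact (H.obj (K.X j))
          have := hS.mono_f
          exact ShortComplex.ShortExact.mk' (hS.exact.map_of_mono_of_preservesKernel F inferInstance
            inferInstance) (inferInstance : Mono (F.map (E.η _))) (hP.epi_map _ hS (hK j))

end

end CategoryTheory

universe v

/-! ### Derived adjunctions and comparison of derived functors -/

namespace CategoryTheory

open Limits

namespace LocalizerMorphism

variable {C₀ C₁ C₂ D₁ D₂ : Type*} [Category* C₀] [Category* C₁] [Category* C₂] [Category* D₁]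
  [Category* D₂] {W₀ : MorphismProperty C₀} {W₁ : MorphismProperty C₁} {W₂ : MorphismProperty C₂}

/-- Let `G ⊣ R` be an adjunction such that `G` preserves weak equivalences and `R` can be derived
using a right derivability structure. Then the functor induced by `G` on localized categories has
a right adjoint. -/
lemma Derives.exists_adjunction {Ψ : LocalizerMorphism W₀ W₂} [Ψ.IsRightDerivabilityStructure]
    {G : C₁ ⥤ C₂} {R : C₂ ⥤ C₁} {L₁ : C₁ ⥤ D₁} (h : Ψ.Derives (R ⋙ L₁)) (adj : G ⊣ R)
    [L₁.IsLocalization W₁] (L₂ : C₂ ⥤ D₂) [L₂.IsLocalization W₂] {G' : D₁ ⥤ D₂}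
    (e : L₁ ⋙ G' ≅ G ⋙ L₂) : ∃ R' : D₂ ⥤ D₁, Nonempty (G' ⊣ R') := by
  have := h.hasPointwiseRightDerivedFunctor
  let R' : D₂ ⥤ D₁ := (R ⋙ L₁).totalRightDerived L₂ W₂
  let β : R ⋙ L₁ ⟶ L₂ ⋙ R' := (R ⋙ L₁).totalRightDerivedUnit L₂ W₂
  have hβ (X) : IsIso (β.app (Ψ.functor.obj X)) := h.isIso_of_isRightDerivedFunctor β X
  -- `G` preserves weak equivalences, so its induced functor is its own left derived functor, also
  -- after composition with `R'`. With the matching statement for `R' ⋙ G'`, the unit and counit of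
  -- `adj` pass to the localizations.
  have : G'.IsLeftDerivedFunctor e.hom W₁ := Functor.isLeftDerivedFunctor_of_inverts _ _ _
  have : (G' ⋙ R').IsLeftDerivedFunctor
      ((Functor.associator _ _ _).inv ≫ Functor.whiskerRight e.hom R') W₁ :=
    Functor.isLeftDerivedFunctor_of_inverts W₁ (G' ⋙ R')
      ((Functor.associator _ _ _).symm ≪≫ Functor.isoWhiskerRight e R')
  have h' : Ψ.Derives ((R ⋙ L₁) ⋙ G') := fun _ _ f hf ↦
    have := h f hf
    inferInstanceAs (IsIso (G'.map ((Ψ.functor ⋙ R ⋙ L₁).map f)))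
  have : (R' ⋙ G').IsRightDerivedFunctor
      (Functor.whiskerRight β G' ≫ (Functor.associator _ _ _).hom) W₂ :=
    h'.isRightDerivedFunctor_of_isIso _ fun X ↦ by
      have := hβ X
      rw [NatTrans.comp_app]
      dsimp
      infer_instance
  exact ⟨R', ⟨adj.derived W₁ W₂ e.hom β⟩⟩

end LocalizerMorphism

section

variable {A : Type*} [Category* A] [Abelian A]

variable (A) in
/-- The localization functor from bounded below cochain complexes to the bounded below derived
category. -/
noncomputable abbrev plusLocalization [HasDerivedCategory A] :
    CochainComplex.Plus A ⥤ DerivedCategory.Plus A :=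
  HomotopyCategory.Plus.quotient A ⋙ DerivedCategory.Plus.Qh

variable {B : Type*} [Category* B] [Abelian B]

/-- The right derived functor on bounded below derived categories is the functor induced by any
functor `Φ` between categories of complexes which preserves quasi-isomorphisms and is
quasi-isomorphic to `F` on complexes of injective objects. -/
lemma nonempty_rightDerivedFunctorPlus_iso [HasDerivedCategory A] [HasDerivedCategory B]
    [EnoughInjectives A] (F : A ⥤ B) [F.Additive]
    {Φ : CochainComplex.Plus A ⥤ CochainComplex.Plus B} (α : F.mapCochainComplexPlus ⟶ Φ)
    (hα : ∀ K : CochainComplex.Plus A, (∀ n, Injective (K.obj.X n)) →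
      CochainComplex.Plus.quasiIso B (α.app K))
    {G' : DerivedCategory.Plus A ⥤ DerivedCategory.Plus B}
    (e : plusLocalization A ⋙ G' ≅ Φ ⋙ plusLocalization B) :
    Nonempty (F.rightDerivedFunctorPlus ≅ G') := by
  let L := plusLocalization A
  let L' := plusLocalization B
  let FC := F.mapCochainComplexPlus ⋙ L'
  let c : FC ≅ HomotopyCategory.Plus.quotient A ⋙ F.mapHomotopyCategoryPlus ⋙
    DerivedCategory.Plus.Qh := Iso.refl _
  let β : FC ⟶ L ⋙ F.rightDerivedFunctorPlus :=
    c.hom ≫ Functor.whiskerLeft (HomotopyCategory.Plus.quotient A) F.rightDerivedFunctorPlusUnit ≫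
      (Functor.associator _ _ _).inv
  let γ : FC ⟶ L ⋙ G' := Functor.whiskerRight α L' ≫ e.inv
  let Ψ := CochainComplex.Plus.localizerMorphism A
  have hβ (X) : IsIso (β.app (Ψ.functor.obj X)) := by
    have : IsIso (F.rightDerivedFunctorPlusUnit.app
      ((HomotopyCategory.Plus.quotient A).obj
        ((InjectiveObject.ι A).mapCochainComplexPlus.obj X))) := inferInstance
    have : IsIso ((Functor.whiskerLeft (HomotopyCategory.Plus.quotient A)
      F.rightDerivedFunctorPlusUnit).app (Ψ.functor.obj X)) := this
    simp only [β, NatTrans.comp_app]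
    infer_instance
  have hγ (X) : IsIso (γ.app (Ψ.functor.obj X)) := by
    have : IsIso (L'.map (α.app (Ψ.functor.obj X))) :=
      Localization.inverts L' (CochainComplex.Plus.quasiIso B) _ (hα _ fun n ↦ (X.obj.X n).property)
    simp only [γ, NatTrans.comp_app, Functor.whiskerRight_app]
    infer_instance
  -- On complexes of injectives `γ` is invertible, and `L ⋙ G'` inverts quasi-isomorphisms, hence so
  -- does `FC`. Thus `β` and `γ` both exhibit right derived functors of `FC`, and uniqueness
  -- identifies them.
  have h : Ψ.Derives FC := by
    intro X Y f hf
    have : IsIso (L.map (Ψ.functor.map f)) :=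
      Localization.inverts L (CochainComplex.Plus.quasiIso A) _ hf
    have := hγ X
    have := hγ Y
    have h1 := γ.naturality (Ψ.functor.map f)
    have : IsIso ((L ⋙ G').map (Ψ.functor.map f)) :=
      inferInstanceAs (IsIso (G'.map (L.map (Ψ.functor.map f))))
    have : IsIso (FC.map (Ψ.functor.map f) ≫ γ.app (Ψ.functor.obj Y)) := by
      rw [h1]
      infer_instance
    have : IsIso (FC.map (Ψ.functor.map f)) :=
      IsIso.of_isIso_comp_right _ (γ.app (Ψ.functor.obj Y))
    exact this
  have := h.isRightDerivedFunctor_of_isIso β hβ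
  have := h.isRightDerivedFunctor_of_isIso γ hγ
  exact ⟨Functor.rightDerivedUnique _ _ β γ (CochainComplex.Plus.quasiIso A)⟩

end

end CategoryTheory

/-! ### Right adjoints on bounded below complexes -/

namespace CochainComplex

open CategoryTheory Limits HomotopicalAlgebra

variable {A B : Type*} [Category* A] [Category* B] [Abelian A] [Abelian B]

namespace Plus

open modelCategoryQuillen

/-- The right adjoint of a functor preserving monomorphisms between categories of bounded below
complexes preserves quasi-isomorphisms between complexes of injective objects. -/
lemma quasiIso_map_of_adjunction [EnoughInjectives A] [EnoughInjectives B]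
    {Φ : Plus A ⥤ Plus B} {Γ : Plus B ⥤ Plus A} (adj : Φ ⊣ Γ)
    (hΦ : ∀ ⦃X Y : Plus A⦄ (i : X ⟶ Y), Mono i → Mono (Φ.map i))
    {K L : Plus B} (hK : ∀ n, Injective (K.obj.X n)) (hL : ∀ n, Injective (L.obj.X n))
    (f : K ⟶ L) (hf : quasiIso B f) : quasiIso A (Γ.map f) := by
  -- Cofibrations are the monomorphisms, so by adjunction `Γ` preserves the right lifting property
  -- that defines trivial fibrations.
  have key ⦃X Y : Plus B⦄ (p : X ⟶ Y) [Fibration p] [WeakEquivalence p] :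
      WeakEquivalence (Γ.map p) := by
    have : trivialFibrations _ (Γ.map p) := by
      rw [← cofibrations_rlp]
      intro U V i hi
      rw [← adj.hasLiftingProperty_iff]
      have : Mono (Φ.map i) := hΦ i ((modelCategoryQuillen.cofibration_iff i).1 ⟨hi⟩)
      infer_instance
    exact ⟨this.2⟩
  have : IsFibrant K := (modelCategoryQuillen.isFibrant_iff K).2 hK
  have : IsFibrant L := (modelCategoryQuillen.isFibrant_iff L).2 hL
  have : WeakEquivalence f := ⟨hf⟩
  -- Ken Brown's argument: `f` is `φ.i` followed by the trivial fibration `φ.p`, and `φ.i` is a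
  -- section of the trivial fibration `φ.r`.
  let φ : FibrantBrownFactorization f := Classical.arbitrary _
  have h1 := key φ.r
  have h2 := key φ.p
  have h3 : WeakEquivalence (Γ.map φ.i) := by
    have : WeakEquivalence (Γ.map φ.i ≫ Γ.map φ.r) := by
      rw [← Γ.map_comp, φ.i_r, Γ.map_id]
      infer_instance
    exact weakEquivalence_of_postcomp _ (Γ.map φ.r)
  have h4 : WeakEquivalence (Γ.map f) := by
    rw [← φ.fac, Γ.map_comp]
    infer_instance
  exact h4.1

end Plus

lemma eq_zero_of_isStrictlyLE_of_isStrictlyGE {K L : CochainComplex A ℤ} (f : K ⟶ L) (m n : ℤ)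
    (h : m < n) [K.IsStrictlyLE m] [L.IsStrictlyGE n] : f = 0 := by
  ext i
  by_cases hi : m < i
  · exact (K.isZero_of_isStrictlyLE m i).eq_of_src _ _
  · exact (L.isZero_of_isStrictlyGE n i).eq_of_tgt _ _

/-- The right adjoint of a functor which preserves upper bounds also preserves lower bounds. -/
lemma isStrictlyGE_of_adjunction {Φ : CochainComplex A ℤ ⥤ CochainComplex B ℤ}
    {Γ : CochainComplex B ℤ ⥤ CochainComplex A ℤ} (adj : Φ ⊣ Γ) (r : ℤ)
    (hr : ∀ (K : CochainComplex A ℤ) (n : ℤ), K.IsStrictlyLE n → (Φ.obj K).IsStrictlyLE (n + r))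
    (L : CochainComplex B ℤ) (m : ℤ) [L.IsStrictlyGE m] :
    (Γ.obj L).IsStrictlyGE (m - r - 1) := by
  rw [isStrictlyGE_iff]
  intro i hi
  have hi' : (ComplexShape.up ℤ).Rel i (i + 1) := rfl
  -- The disc on `(Γ L)ⁱ` in degrees `i` and `i + 1` maps to `Γ L` by the identity in degree `i`.
  -- Its image under `Φ` lies in degrees at most `i + 1 + r < m`, so the adjoint map is zero; the
  -- top degree of the disc accounts for the `- 1` in the bound.
  let K : CochainComplex A ℤ := HomologicalComplex.double (𝟙 ((Γ.obj L).X i)) hi'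
  let x : K ⟶ Γ.obj L := HomologicalComplex.mkHomFromDouble hi' (by lia) (𝟙 _)
    ((Γ.obj L).d i (i + 1)) (by simp) (by simp)
  have hK : K.IsStrictlyLE (i + 1) := by
    rw [isStrictlyLE_iff]
    exact fun j hj ↦ HomologicalComplex.isZero_double_X _ _ _ (by lia) (by lia)
  have := hr K (i + 1) hK
  have hx : x = 0 := (adj.homEquiv K L).symm.injective
    ((eq_zero_of_isStrictlyLE_of_isStrictlyGE _ (i + 1 + r) m (by lia)).trans
      (eq_zero_of_isStrictlyLE_of_isStrictlyGE _ (i + 1 + r) m (by lia)).symm)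
  have hx' := HomologicalComplex.congr_hom hx i
  rw [HomologicalComplex.mkHomFromDouble_f₀] at hx'
  rw [IsZero.iff_id_eq_zero]
  rw [← cancel_epi (HomologicalComplex.doubleXIso₀ (𝟙 ((Γ.obj L).X i)) hi').hom]
  simpa using hx'

/-- A cocontinuous exact functor between categories of cochain complexes in Grothendieck abelian
categories induces a functor between bounded below complexes which has a right adjoint. -/
lemma IsCocontinuousExact.exists_adjunction_plus {A B : Type*} [Category.{v} A] [Category.{v} B]
    [Abelian A] [Abelian B] [IsGrothendieckAbelian.{v} A]
    {Φ : CochainComplex A ℤ ⥤ CochainComplex B ℤ} (hΦ : IsCocontinuousExact Φ) :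
    ∃ (Φ' : Plus A ⥤ Plus B) (Γ : Plus B ⥤ Plus A) (_ : Φ' ⊣ Γ),
      Nonempty (Φ' ⋙ Plus.ι B ≅ Plus.ι A ⋙ Φ) := by
  have := hΦ.preservesColimits
  obtain ⟨r, hr⟩ := hΦ.exists_isStrictlyLE
  have : IsGrothendieckAbelian.{v} (CochainComplex A ℤ) := inferInstance
  -- The special adjoint functor theorem applies because Grothendieck complexes have a separator.
  have : Φ.IsLeftAdjoint :=
    isLeftAdjoint_of_preservesColimits_of_isSeparating (isSeparator_separator _) Φ
  let adj := Adjunction.ofIsLeftAdjoint Φ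
  refine ⟨ObjectProperty.lift _ (Plus.ι A ⋙ Φ) fun K ↦ ?_,
    ObjectProperty.lift _ (Plus.ι B ⋙ Φ.rightAdjoint) fun L ↦ ?_,
    adj.restrictFullyFaithful (Plus.fullyFaithfulι A) (Plus.fullyFaithfulι B) (Iso.refl _)
      (Iso.refl _), ⟨Iso.refl _⟩⟩
  · obtain ⟨n, hn⟩ := K.2
    exact ⟨n, hΦ.isStrictlyGE _ _ hn⟩
  · obtain ⟨n, hn⟩ := L.2
    exact ⟨_, isStrictlyGE_of_adjunction adj r hr L.obj n⟩

end CochainComplex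

/-! ### The abstract existence theorem -/

namespace CategoryTheory

open Limits

/-- A left exact functor `F` of finite cohomological dimension which preserves coproducts has a
right derived functor with a right adjoint, provided that there is a class `P` of
objects which is adapted to `F` and functorial exact embeddings into objects in `P`. -/
theorem exists_rightAdjoint_rightDerivedFunctorPlus {A B : Type*} [Category.{v} A] [Category.{v} B]
    [Abelian A] [Abelian B] [HasDerivedCategory A] [HasDerivedCategory B]
    [IsGrothendieckAbelian.{v} A] [IsGrothendieckAbelian.{v} B]
    {F : A ⥤ B} [F.Additive] [PreservesFiniteLimits F]
    [∀ J : Type v, PreservesColimitsOfShape (Discrete J) F]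
    {P : ObjectProperty A} (hP : IsAdaptedClass F P)
    {T : A ⥤ A} [T.Additive] [PreservesFiniteLimits T] [PreservesColimits T]
    (E : FunctorialShortExact T) (hT : ∀ M, P (T.obj M))
    (d : ℕ) (hd : ∀ M, IsZero ((F.rightDerived (d + 1)).obj M)) :
    ∃ R : DerivedCategory.Plus B ⥤ DerivedCategory.Plus A,
      Nonempty (F.rightDerivedFunctorPlus ⊣ R) := by
  obtain ⟨Φ, α, hΦ, hα⟩ := exists_isCocontinuousExact hP E hT d (𝟭 A) fun M ↦
    hP.hasAdaptedDimensionLE_of_isZero_rightDerived d M (hd M)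
  obtain ⟨Φ', Γ, adj, ⟨e⟩⟩ := hΦ.exists_adjunction_plus
  have he {K L : CochainComplex.Plus A} (f : K ⟶ L) :
      e.inv.app K ≫ (Φ'.map f).hom ≫ e.hom.app L = Φ.map f.hom := by
    have := e.hom.naturality f
    dsimp at this
    rw [this]
    simp
  have h1 : (CochainComplex.Plus.quasiIso A).IsInvertedBy (Φ' ⋙ plusLocalization B) := by
    intro K L f hf
    refine Localization.inverts (plusLocalization B) (CochainComplex.Plus.quasiIso B) _ ?_
    have := hΦ.quasiIso_map f.hom hf
    have : (Φ'.map f).hom = e.hom.app K ≫ Φ.map f.hom ≫ e.inv.app L := by simp [← he]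
    change QuasiIso (Φ'.map f).hom
    rw [this]
    infer_instance
  have h2 {K L : CochainComplex.Plus A} (f : K ⟶ L) (hf : Mono f) : Mono (Φ'.map f) := by
    rw [CochainComplex.Plus.mono_iff] at hf ⊢
    have := hΦ.mono_map f.hom hf
    have : (Φ'.map f).hom = e.hom.app K ≫ Φ.map f.hom ≫ e.inv.app L := by simp [← he]
    rw [this]
    infer_instance
  have h3 : (CochainComplex.Plus.localizerMorphism B).Derives (Γ ⋙ plusLocalization A) := by
    intro K L f hf
    exact Localization.inverts (plusLocalization A) (CochainComplex.Plus.quasiIso A) _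
      (CochainComplex.Plus.quasiIso_map_of_adjunction adj @h2 (fun n ↦ (K.obj.X n).property)
        (fun n ↦ (L.obj.X n).property) _ hf)
  let G' := Localization.lift _ h1 (plusLocalization A)
  let e' : plusLocalization A ⋙ G' ≅ Φ' ⋙ plusLocalization B := Localization.fac _ h1 _
  let α' : F.mapCochainComplexPlus ⟶ Φ' :=
    { app K := ObjectProperty.homMk (α.app K.obj ≫ e.inv.app K)
      naturality K L f := by
        ext1
        have h := α.naturality_assoc f.hom (e.inv.app L)
        have h' := e.inv.naturality f
        dsimp at h h'
        rw [h'] at h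
        exact h.trans (Category.assoc _ _ _).symm }
  obtain ⟨i⟩ := nonempty_rightDerivedFunctorPlus_iso F α' (fun K hK ↦ by
    have := hα K.obj fun n ↦ hP.injective (K.obj.X n)
    exact inferInstanceAs (QuasiIso (α.app K.obj ≫ e.inv.app K))) e'
  obtain ⟨R, ⟨adj'⟩⟩ := h3.exists_adjunction
    (W₁ := CochainComplex.Plus.quasiIso A) adj (plusLocalization B) e'
  exact ⟨R, ⟨adj'.ofNatIsoLeft i.symm⟩⟩

end CategoryTheory

/-! ### Sections, supports and gluing for abelian sheaves -/

namespace AbSheaf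

open Limits

/-- Sheaves of abelian groups on a topological space. -/
abbrev AbSh (Y : TopCat.{u}) := TopCat.Sheaf AddCommGrpCat.{u} Y

variable {Y : TopCat.{u}}

/-- The group of sections of a sheaf over an open set. -/
def Sec (N : AbSh Y) (V : Opens Y) : Type u := N.obj.obj (op V)

noncomputable instance (N : AbSh Y) (V : Opens Y) : AddCommGroup (Sec N V) :=
  inferInstanceAs (AddCommGroup (N.obj.obj (op V)))

/-- Restriction of sections. -/
noncomputable def res {N : AbSh Y} {V W : Opens Y} (h : W ≤ V) : Sec N V →+ Sec N W :=
  (N.obj.map (homOfLE h).op).hom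

/-- The action of a morphism of sheaves on sections. -/
noncomputable def app {M N : AbSh Y} (φ : M ⟶ N) (V : Opens Y) : Sec M V →+ Sec N V :=
  (φ.hom.app (op V)).hom

variable {M N K : AbSh Y} {U V W : Opens Y}

@[simp]
theorem res_self (h : V ≤ V) (s : Sec N V) : res h s = s := by
  change N.obj.map (𝟙 _) s = s
  rw [N.obj.map_id]
  rfl

@[simp]
theorem res_res (h : W ≤ V) (h' : U ≤ W) (s : Sec N V) : res h' (res h s) = res (h'.trans h) s := by
  change _ = N.obj.map ((homOfLE h).op ≫ (homOfLE h').op) s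
  rw [N.obj.map_comp]
  rfl

theorem app_res (φ : M ⟶ N) (h : W ≤ V) (s : Sec M V) : app φ W (res h s) = res h (app φ V s) :=
  NatTrans.naturality_apply φ.hom (homOfLE h).op s

@[simp]
theorem app_comp (φ : M ⟶ N) (ψ : N ⟶ K) (s : Sec M V) : app (φ ≫ ψ) V s = app ψ V (app φ V s) :=
  rfl

@[simp]
theorem app_id (s : Sec M V) : app (𝟙 M) V s = s := rfl

@[simp]
theorem app_zero (s : Sec M V) : app (0 : M ⟶ N) V s = 0 := rfl

theorem hom_ext {φ ψ : M ⟶ N} (h : ∀ (V : Opens Y) (s : Sec M V), app φ V s = app ψ V s) :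
    φ = ψ := by
  apply CategoryTheory.Sheaf.hom_ext
  ext V s
  exact h V.unop s

/-- Morphisms of sheaves are families of homomorphisms compatible with restrictions. -/
noncomputable def homMk (φ : ∀ V : Opens Y, Sec M V →+ Sec N V)
    (hφ : ∀ (V W : Opens Y) (h : W ≤ V) (s : Sec M V), φ W (res h s) = res h (φ V s)) : M ⟶ N :=
  ⟨{ app := fun V ↦ AddCommGrpCat.ofHom (φ V.unop)
     naturality := fun V W i ↦ by
      ext s
      exact hφ V.unop W.unop i.unop.le s }⟩

/-- Sections that agree locally are equal. -/
theorem sec_ext {s t : Sec N V}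
    (h : ∀ y ∈ V, ∃ (W : Opens Y) (hW : W ≤ V), y ∈ W ∧ res hW s = res hW t) : s = t := by
  choose! W hW hy hst using h
  refine N.eq_of_locally_eq' (fun y : V ↦ W y.1) V (fun y ↦ homOfLE (hW y.1 y.2)) ?_ s t ?_
  · intro y hyV
    exact Opens.mem_iSup.mpr ⟨⟨y, hyV⟩, hy y hyV⟩
  · rintro ⟨y, hyV⟩
    exact hst y hyV

/-- Gluing of a compatible family of sections. -/
theorem exists_glue {ι : Type u} (W : ι → Opens Y) (hW : ∀ i, W i ≤ V)
    (hV : ∀ y ∈ V, ∃ i, y ∈ W i) (s : ∀ i, Sec N (W i))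
    (hs : ∀ i j, res (N := N) (inf_le_left : W i ⊓ W j ≤ W i) (s i) =
      res (N := N) (inf_le_right : W i ⊓ W j ≤ W j) (s j)) :
    ∃ t : Sec N V, ∀ i, res (hW i) t = s i := by
  obtain ⟨t, ht, -⟩ := N.existsUnique_gluing' W V (fun i ↦ homOfLE (hW i))
    (fun y hy ↦ Opens.mem_iSup.mpr (hV y hy)) s hs
  exact ⟨t, ht⟩

/-- Gluing of two sections. -/
theorem exists_glue₂ {W₁ W₂ : Opens Y} (h₁ : W₁ ≤ V) (h₂ : W₂ ≤ V)
    (hV : ∀ y ∈ V, y ∈ W₁ ∨ y ∈ W₂) (s₁ : Sec N W₁) (s₂ : Sec N W₂)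
    (hs : res (inf_le_left : W₁ ⊓ W₂ ≤ W₁) s₁ = res (inf_le_right : W₁ ⊓ W₂ ≤ W₂) s₂) :
    ∃ t : Sec N V, res h₁ t = s₁ ∧ res h₂ t = s₂ := by
  have hs' : res (N := N) (inf_le_right : W₂ ⊓ W₁ ≤ W₁) s₁ =
      res (N := N) (inf_le_left : W₂ ⊓ W₁ ≤ W₂) s₂ := by
    have := congrArg (res (N := N) (le_of_eq (inf_comm W₂ W₁))) hs
    simpa using this
  obtain ⟨t, ht⟩ := exists_glue (N := N) (V := V) (ι := ULift Bool)
    (fun b ↦ Bool.rec W₁ W₂ b.down) (by rintro ⟨_ | _⟩ <;> assumption)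
    (fun y hy ↦ (hV y hy).elim (fun h ↦ ⟨⟨false⟩, h⟩) (fun h ↦ ⟨⟨true⟩, h⟩))
    (fun b ↦ Bool.rec (motive := fun c ↦ Sec N (Bool.rec W₁ W₂ c)) s₁ s₂ b.down)
    (by
      rintro ⟨_ | _⟩ ⟨_ | _⟩
      · rfl
      · exact hs
      · exact hs'.symm
      · rfl)
  exact ⟨t, ht ⟨false⟩, ht ⟨true⟩⟩

/-- The support of a section of a sheaf. -/
def supp (s : Sec N V) : Set Y := sectionSupport N.obj (V := V) s

theorem not_mem_supp_iff {s : Sec N V} {y : Y} (hy : y ∈ V) :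
    y ∉ supp s ↔ ∃ (W : Opens Y) (hW : W ≤ V), y ∈ W ∧ res hW s = 0 := by
  refine (not_mem_sectionSupport_iff (F := N.obj) hy).trans ?_
  constructor
  · intro h
    obtain ⟨W, hW, i, j, hij⟩ := TopCat.Presheaf.germ_eq N.obj y hy hy s 0 (by rw [h, map_zero])
    rw [map_zero] at hij
    exact ⟨W, i.le, hW, hij⟩
  · rintro ⟨W, hW, hyW, h⟩
    refine (TopCat.Presheaf.germ_res_apply N.obj (homOfLE hW) y hyW s).symm.trans ?_
    change TopCat.Presheaf.germ N.obj W y hyW (res hW s) = 0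
    rw [h]
    exact map_zero (TopCat.Presheaf.germ N.obj W y hyW).hom

theorem supp_subset (s : Sec N V) : supp s ⊆ V := fun _ h ↦ h.1

theorem supp_res (h : W ≤ V) (s : Sec N V) : supp (res h s) = supp s ∩ W :=
  sectionSupport_res N.obj (homOfLE h) s

theorem supp_app_subset (φ : M ⟶ N) (s : Sec M V) : supp (app φ V s) ⊆ supp s :=
  sectionSupport_map_subset φ.hom s

theorem eq_zero_iff_supp {s : Sec N V} : s = 0 ↔ supp s = ∅ := by
  refine ⟨fun h ↦ by rw [h]; exact sectionSupport_zero _ _, fun h ↦ sec_ext fun y hy ↦ ?_⟩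
  obtain ⟨W, hW, hyW, h'⟩ := (not_mem_supp_iff hy).mp (h ▸ Set.notMem_empty y)
  exact ⟨W, hW, hyW, by rw [h', map_zero]⟩

theorem res_eq_zero_iff (h : W ≤ V) (s : Sec N V) : res h s = 0 ↔ supp s ∩ W = ∅ := by
  rw [eq_zero_iff_supp, supp_res]

/-- The open complement of the support of a section within its domain. -/
def zeroOpens (s : Sec N V) : Opens Y where
  carrier := {y | y ∈ V ∧ y ∉ supp s}
  is_open' := by
    rw [isOpen_iff_forall_mem_open]
    rintro y ⟨hy, h⟩
    obtain ⟨W, hW, hyW, h'⟩ := (not_mem_supp_iff hy).mp h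
    exact ⟨W, fun z hz ↦ ⟨hW hz, (not_mem_supp_iff (hW hz)).mpr ⟨W, hW, hz, h'⟩⟩, W.isOpen, hyW⟩

theorem zeroOpens_le (s : Sec N V) : zeroOpens s ≤ V := fun _ h ↦ h.1

theorem res_zeroOpens (s : Sec N V) : res (zeroOpens_le s) s = 0 := by
  rw [res_eq_zero_iff]
  ext y
  simp only [Set.mem_inter_iff, Set.mem_empty_iff_false, iff_false]
  exact fun h ↦ h.2.2 h.1

/-- A section over `W` whose support is closed in `V` extends by zero to `V`. -/
theorem exists_extend_zero (h : W ≤ V) (s : Sec N W) (O : Opens Y) (hO : O ≤ V)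
    (hcov : ∀ y ∈ V, y ∈ W ∨ y ∈ O) (hs : ∀ y ∈ O, y ∉ supp s) :
    ∃ t : Sec N V, res h t = s ∧ supp t = supp s := by
  obtain ⟨t, ht, ht'⟩ := exists_glue₂ h hO hcov s 0 (by
    rw [map_zero, res_eq_zero_iff]
    ext y
    simp only [Set.mem_inter_iff, Set.mem_empty_iff_false, iff_false]
    exact fun hy ↦ hs y hy.2.2 hy.1)
  refine ⟨t, ht, ?_⟩
  ext y
  constructor
  · intro hy
    rcases hcov y (supp_subset t hy) with h' | h'
    · rw [← ht, supp_res]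
      exact ⟨hy, h'⟩
    · exact absurd (show y ∈ supp t ∩ O from ⟨hy, h'⟩)
        (by rw [(res_eq_zero_iff hO t).mp ht']; exact Set.notMem_empty y)
  · intro hy
    rw [← ht, supp_res] at hy
    exact hy.1

theorem mono_iff_injective (φ : M ⟶ N) :
    Mono φ ↔ ∀ V : Opens Y, Function.Injective (app φ V) := by
  constructor
  · intro h V
    have : Mono φ.hom := (TopCat.Sheaf.forget AddCommGrpCat.{u} Y).map_mono φ
    exact (AddCommGrpCat.mono_iff_injective (φ.hom.app (op V))).mp inferInstance
  · intro h
    refine ⟨fun {Z} a b hab ↦ hom_ext fun V s ↦ h V ?_⟩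
    rw [← app_comp, ← app_comp, hab]

theorem epi_iff_locallySurjective (φ : M ⟶ N) :
    Epi φ ↔ ∀ (V : Opens Y) (s : Sec N V), ∀ y ∈ V,
      ∃ (W : Opens Y) (hW : W ≤ V), y ∈ W ∧ ∃ t : Sec M W, app φ W t = res hW s := by
  rw [← TopCat.Sheaf.isLocallySurjective_iff_epi, TopCat.Presheaf.isLocallySurjective_iff]
  constructor
  · intro h V s y hy
    obtain ⟨W, hW, ⟨t, ht⟩, hyW⟩ := h V s y hy
    exact ⟨W, hW, hyW, t, ht⟩
  · intro h V s y hy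
    obtain ⟨W, hW, hyW, t, ht⟩ := h V s y hy
    exact ⟨W, hW, ⟨t, ht⟩, hyW⟩

end AbSheaf

/-! ### Stalks, exactness and a local criterion for coproducts -/

namespace AbSheaf

open Limits
variable {Y : TopCat.{u}} {M N K : AbSh Y} {U V W : Opens Y}

section Stalks

/-- The stalk functor on sheaves of abelian groups. -/
noncomputable def stalk (y : Y) : AbSh Y ⥤ AddCommGrpCat.{u} :=
  TopCat.Sheaf.forget AddCommGrpCat.{u} Y ⋙ TopCat.Presheaf.stalkFunctor AddCommGrpCat.{u} y

instance (y : Y) : (stalk y).IsLeftAdjoint :=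
  inferInstanceAs (TopCat.Sheaf.forget AddCommGrpCat.{u} Y ⋙
    TopCat.Presheaf.stalkFunctor AddCommGrpCat.{u} y).IsLeftAdjoint

instance (y : Y) : (stalk y).Additive :=
  inferInstanceAs (TopCat.Sheaf.forget AddCommGrpCat.{u} Y ⋙
    TopCat.Presheaf.stalkFunctor AddCommGrpCat.{u} y).Additive

/-- The germ of a section at a point. -/
noncomputable def germ {y : Y} (hy : y ∈ V) : Sec N V →+ (stalk y).obj N :=
  (TopCat.Presheaf.germ N.obj V y hy).hom

theorem stalk_map_germ (φ : M ⟶ N) {y : Y} (hy : y ∈ V) (s : Sec M V) :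
    (stalk y).map φ (germ hy s) = germ hy (app φ V s) :=
  TopCat.Presheaf.stalkFunctor_map_germ_apply V y hy φ.hom s

theorem exists_germ_eq {y : Y} (x : (stalk y).obj N) :
    ∃ (V : Opens Y) (hy : y ∈ V) (s : Sec N V), germ hy s = x :=
  TopCat.Presheaf.exists_germ_eq N.obj x

theorem germ_res {y : Y} (h : W ≤ V) (hy : y ∈ W) (s : Sec N V) :
    germ hy (res h s) = germ (h hy) s :=
  TopCat.Presheaf.germ_res_apply N.obj (homOfLE h) y hy s

theorem exists_res_eq_of_germ_eq {y : Y} {hV : y ∈ V} {hW : y ∈ W} {s : Sec N V} {t : Sec N W}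
    (h : germ hV s = germ hW t) :
    ∃ (O : Opens Y) (h₁ : O ≤ V) (h₂ : O ≤ W), y ∈ O ∧ res h₁ s = res h₂ t := by
  obtain ⟨O, hO, i, j, hij⟩ := TopCat.Presheaf.germ_eq N.obj y hV hW s t h
  exact ⟨O, i.le, j.le, hO, hij⟩

end Stalks

theorem exact_iff (S : ShortComplex (AbSh Y)) :
    S.Exact ↔ ∀ (V : Opens Y) (s : Sec S.X₂ V), app S.g V s = 0 → ∀ y ∈ V,
      ∃ (W : Opens Y) (hW : W ≤ V), y ∈ W ∧ ∃ t : Sec S.X₁ W, app S.f W t = res hW s := by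
  rw [TopCat.Sheaf.exact_iff_stalkFunctor_map_exact]
  have h1 (y : Y) : (S.map (TopCat.Sheaf.forget AddCommGrpCat.{u} Y ⋙
      TopCat.Presheaf.stalkFunctor AddCommGrpCat.{u} y)).Exact ↔
      ∀ b, (stalk y).map S.g b = 0 → ∃ a, (stalk y).map S.f a = b := ShortComplex.ab_exact_iff _
  simp only [h1]
  constructor
  · intro h V s hs y hy
    obtain ⟨a, ha⟩ := h y (germ hy s) (by rw [stalk_map_germ, hs, map_zero])
    obtain ⟨W, hyW, t, rfl⟩ := exists_germ_eq a
    rw [stalk_map_germ] at ha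
    obtain ⟨O, i, j, hyO, hij⟩ := exists_res_eq_of_germ_eq ha
    exact ⟨O, j, hyO, res i t, by rw [app_res, hij]⟩
  · intro h y b hb
    obtain ⟨V, hy, s, rfl⟩ := exists_germ_eq b
    rw [stalk_map_germ, ← map_zero (germ (N := S.X₃) hy)] at hb
    obtain ⟨O, hO, _, hyO, hs⟩ := exists_res_eq_of_germ_eq hb
    obtain ⟨W, hW, hyW, t, ht⟩ := h O (res hO s) (by rw [app_res, hs, map_zero]) y hyO
    exact ⟨germ hyW t, by rw [stalk_map_germ, ht, res_res, germ_res]⟩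

theorem exists_app_f_eq {S : ShortComplex (AbSh Y)} (hS : S.Exact) [Mono S.f] (s : Sec S.X₂ V)
    (hs : app S.g V s = 0) : ∃ t : Sec S.X₁ V, app S.f V t = s :=
  TopCat.Sheaf.sections_exact_of_left_exact hS inferInstance s hs

theorem app_g_f (S : ShortComplex (AbSh Y)) (s : Sec S.X₁ V) : app S.g V (app S.f V s) = 0 := by
  rw [← app_comp, S.zero, app_zero]

/-- Left exactness, checked on sections. -/
theorem exact_of_sections (S : ShortComplex (AbSh Y))
    (h : ∀ (V : Opens Y) (s : Sec S.X₂ V), app S.g V s = 0 → ∃ t : Sec S.X₁ V, app S.f V t = s) :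
    S.Exact :=
  (exact_iff S).mpr fun V s hs y hy ↦ by
    obtain ⟨t, ht⟩ := h V s hs
    exact ⟨V, le_rfl, hy, t, by rw [ht, res_self]⟩

theorem coproduct_induction {J : Type u} {M : J → AddCommGrpCat.{u}} {c : Cofan M} (hc : IsColimit c)
    (x : c.pt) : x ∈ AddSubgroup.closure (⋃ a, Set.range (c.inj a)) := by
  set H := AddSubgroup.closure (⋃ a, Set.range (c.inj a))
  have h : AddCommGrpCat.ofHom (QuotientAddGroup.mk' H) = 0 := by
    refine Cofan.IsColimit.hom_ext hc _ _ fun a ↦ ?_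
    ext m
    refine (QuotientAddGroup.eq_zero_iff _).mpr (AddSubgroup.subset_closure ?_)
    exact Set.mem_iUnion.mpr ⟨a, m, rfl⟩
  exact (QuotientAddGroup.eq_zero_iff x).mp (ConcreteCategory.congr_hom h x)

/-- A family of endomorphisms of a sheaf is a local resolution of the identity if on any
section, any sufficiently large finite sum of its members is locally the identity. -/
def IsLocalResolution {J : Type u} {N : AbSh Y} (e : J → (N ⟶ N)) : Prop :=
  ∀ (V : Opens Y) (s : Sec N V), ∀ y ∈ V, ∃ (W : Opens Y) (hW : W ≤ V) (S : Finset J), y ∈ W ∧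
    ∀ S', S ⊆ S' → ∑ a ∈ S', app (e a) W (res hW s) = res hW s

/-- Stalks commute with coproducts, so a germ involves only finitely many summands, and an equality
of germs spreads to a neighborhood. -/
theorem isLocalResolution_cofan {J : Type u} {M : J → AbSh Y} {c : Cofan M} (hc : IsColimit c)
    (π : ∀ a, c.pt ⟶ M a) (h₁ : ∀ a, c.inj a ≫ π a = 𝟙 _) (h₂ : ∀ a b, a ≠ b → c.inj a ≫ π b = 0) :
    IsLocalResolution (fun a ↦ π a ≫ c.inj a) := by
  classical
  intro V s y hy
  let c' : Cofan (fun a ↦ (stalk y).obj (M a)) := Cofan.mk ((stalk y).obj c.pt) (fun a ↦ (stalk y).map (c.inj a))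
  have hc' : IsColimit c' := isColimitMapCoconeCofanMkEquiv (stalk y) _ _ (isColimitOfPreserves (stalk y)
    (hc.ofIsoColimit (Cocone.ext (Iso.refl _) (by rintro ⟨a⟩; exact Category.comp_id _))))
  have hcomp : ∀ a b, c.inj a ≫ π b ≫ c.inj b = if a = b then c.inj a else 0 := by
    intro a b
    split_ifs with h
    · subst h
      rw [← Category.assoc, h₁, Category.id_comp]
    · rw [← Category.assoc, h₂ a b h, zero_comp]
  have key : ∀ x ∈ AddSubgroup.closure (⋃ a, Set.range (c'.inj a)),
      ∃ S : Finset J, ∀ S', S ⊆ S' → ∑ a ∈ S', (stalk y).map (π a ≫ c.inj a) x = x := by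
    intro x hx
    induction hx using AddSubgroup.closure_induction with
    | mem x hx =>
      obtain ⟨a, m, rfl⟩ := Set.mem_iUnion.mp hx
      refine ⟨{a}, fun S' hS' ↦ ?_⟩
      have : ∀ b, (stalk y).map (π b ≫ c.inj b) (c'.inj a m) = if a = b then c'.inj a m else 0 := by
        intro b
        change (stalk y).map (π b ≫ c.inj b) ((stalk y).map (c.inj a) m) = if a = b then (stalk y).map (c.inj a) m else 0
        rw [← ConcreteCategory.comp_apply, ← (stalk y).map_comp, hcomp]
        split_ifs
        · rfl
        · rw [(stalk y).map_zero]
          rfl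
      simp only [this, Finset.sum_ite_eq]
      rw [if_pos (hS' (Finset.mem_singleton_self a))]
    | zero => exact ⟨∅, fun S' _ ↦ by simp only [map_zero, Finset.sum_const_zero]⟩
    | add x z _ _ hx hz =>
      obtain ⟨S₁, h₁⟩ := hx
      obtain ⟨S₂, h₂⟩ := hz
      refine ⟨S₁ ∪ S₂, fun S' hS' ↦ ?_⟩
      simp only [map_add, Finset.sum_add_distrib]
      rw [h₁ S' (Finset.union_subset_left hS'), h₂ S' (Finset.union_subset_right hS')]
    | neg x _ hx =>
      obtain ⟨S₁, h₁⟩ := hx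
      refine ⟨S₁, fun S' hS' ↦ ?_⟩
      simp only [map_neg, Finset.sum_neg_distrib]
      rw [h₁ S' hS']
  obtain ⟨S, hS⟩ := key _ (coproduct_induction hc' (germ hy s))
  obtain ⟨W, hWV, _, hyW, hij⟩ := exists_res_eq_of_germ_eq
    (s := ∑ a ∈ S, app (π a ≫ c.inj a) V s) (t := s) (hV := hy) (hW := hy) (by
      refine Eq.trans ?_ (hS S subset_rfl)
      rw [map_sum]
      exact Finset.sum_congr rfl fun a _ ↦ (stalk_map_germ (π a ≫ c.inj a) hy s).symm)
  have hij' : ∑ a ∈ S, app (π a ≫ c.inj a) W (res hWV s) = res hWV s := by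
    simpa only [map_sum, ← app_res] using hij
  refine ⟨W, hWV, S, hyW, fun S' hS' ↦ ?_⟩
  -- Near `y` the section is the sum of its components in `S`, so by orthogonality the projections
  -- with index outside `S` kill it and enlarging `S` changes nothing.
  rw [← Finset.sum_subset hS' fun b _ hb ↦ ?_, hij']
  rw [← hij', map_sum]
  refine Finset.sum_eq_zero fun a ha ↦ ?_
  have hab : a ≠ b := fun h ↦ hb (h ▸ ha)
  have : (π a ≫ c.inj a) ≫ π b ≫ c.inj b = 0 := by
    rw [Category.assoc, hcomp, if_neg hab, comp_zero]
  rw [← app_comp, this, app_zero]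

/-- A cofan whose inclusions admit retractions forming a local resolution of the identity is a
coproduct. -/
theorem nonempty_isColimit_of_isLocalResolution {J : Type u} {M : J → AbSh Y} {N : AbSh Y}
    (ι : ∀ a, M a ⟶ N) (π : ∀ a, N ⟶ M a) (h₁ : ∀ a, ι a ≫ π a = 𝟙 _)
    (h₂ : ∀ a b, a ≠ b → ι a ≫ π b = 0) (h : IsLocalResolution (fun a ↦ π a ≫ ι a)) :
    Nonempty (IsColimit (Cofan.mk N ι)) := by
  classical
  let c : Cofan M := Cofan.mk (∐ M) (Sigma.ι M)
  let σ : ∀ a, ∐ M ⟶ M a := fun a ↦ Sigma.desc fun b ↦ if hb : b = a then eqToHom (by rw [hb]) else 0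
  have hσ₁ : ∀ a, Sigma.ι M a ≫ σ a = 𝟙 _ := fun a ↦ by simp [σ]
  have hσ₂ : ∀ a b, a ≠ b → Sigma.ι M a ≫ σ b = 0 := fun a b hab ↦ by simp [σ, hab]
  have hc := isLocalResolution_cofan (c := c) (coproductIsCoproduct M) σ hσ₁ hσ₂
  let φ : ∐ M ⟶ N := Sigma.desc ι
  have hφ : ∀ a, Sigma.ι M a ≫ φ = ι a := fun a ↦ Sigma.ι_desc _ _
  have hφπ : ∀ a, φ ≫ π a = σ a := fun a ↦ by
    refine Sigma.hom_ext _ _ fun b ↦ ?_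
    rw [← Category.assoc, hφ]
    by_cases hb : b = a
    · subst hb
      rw [h₁, hσ₁]
    · rw [h₂ b a hb, hσ₂ b a hb]
  -- A section killed by `φ` has all components zero and is locally their sum; conversely, sections
  -- of `N` are locally finite sums of components. So `φ` is mono and epi, hence invertible.
  have : Mono φ := by
    rw [mono_iff_injective]
    intro V
    rw [injective_iff_map_eq_zero]
    intro s hs
    have h0 : ∀ a, app (σ a) V s = 0 := fun a ↦ by rw [← hφπ, app_comp, hs, map_zero]
    refine sec_ext fun y hy ↦ ?_
    obtain ⟨W, hW, S, hyW, hS⟩ := hc V s y hy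
    refine ⟨W, hW, hyW, ?_⟩
    rw [map_zero, ← hS S subset_rfl]
    refine Finset.sum_eq_zero fun a _ ↦ ?_
    rw [app_res, app_comp, h0, map_zero, map_zero]
  have : Epi φ := by
    rw [epi_iff_locallySurjective]
    intro V s y hy
    obtain ⟨W, hW, S, hyW, hS⟩ := h V s y hy
    refine ⟨W, hW, hyW, ∑ a ∈ S, app (Sigma.ι M a) W (app (π a) W (res hW s)), ?_⟩
    rw [map_sum]
    refine (Finset.sum_congr rfl fun a _ ↦ ?_).trans (hS S subset_rfl)
    rw [← app_comp, hφ, app_comp]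
  have : IsIso φ := isIso_of_mono_of_epi φ
  exact ⟨(coproductIsCoproduct M).ofIsoColimit (Cocone.ext (asIso φ) (by rintro ⟨a⟩; exact hφ a))⟩

/-- An additive functor preserves coproducts as soon as it preserves local resolutions of the
identity. -/
theorem preservesCoproducts_of_isLocalResolution {X : TopCat.{u}} (F : AbSh Y ⥤ AbSh X)
    [F.Additive] (J : Type u)
    (hF : ∀ (N : AbSh Y) (e : J → (N ⟶ N)), IsLocalResolution e →
      IsLocalResolution (fun a ↦ F.map (e a))) :
    PreservesColimitsOfShape (Discrete J) F := by
  classical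
  have (M : J → AbSh Y) : PreservesColimit (Discrete.functor M) F := ?_
  · exact preservesColimitsOfShape_of_discrete F
  let σ : ∀ a, ∐ M ⟶ M a := fun a ↦ Sigma.desc fun b ↦ if hb : b = a then eqToHom (by rw [hb]) else 0
  have hσ₁ : ∀ a, Sigma.ι M a ≫ σ a = 𝟙 _ := fun a ↦ by simp [σ]
  have hσ₂ : ∀ a b, a ≠ b → Sigma.ι M a ≫ σ b = 0 := fun a b hab ↦ by simp [σ, hab]
  have hc := isLocalResolution_cofan (c := Cofan.mk (∐ M) (Sigma.ι M)) (coproductIsCoproduct M)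
    σ hσ₁ hσ₂
  obtain ⟨h⟩ := nonempty_isColimit_of_isLocalResolution (fun a ↦ F.map (Sigma.ι M a))
    (fun a ↦ F.map (σ a)) (fun a ↦ by rw [← F.map_comp, hσ₁, F.map_id])
    (fun a b hab ↦ by rw [← F.map_comp, hσ₂ a b hab, F.map_zero])
    (by simpa only [F.map_comp] using hF (∐ M) (fun a ↦ σ a ≫ Sigma.ι M a) hc)
  exact preservesColimit_of_preserves_colimit_cocone (coproductIsCoproduct M)
    ((isColimitMapCoconeCofanMkEquiv F M (Sigma.ι M)).symm h)

end AbSheaf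

/-! ### Sheafification and the functor of finite-valued functions -/

namespace AbSheaf

open Limits
variable {Y : TopCat.{u}}

section Sheafification

/-- Sheafification of presheaves of abelian groups. -/
noncomputable def sheafify (Y : TopCat.{u}) : ((Opens Y)ᵒᵖ ⥤ AddCommGrpCat.{u}) ⥤ AbSh Y :=
  presheafToSheaf (Opens.grothendieckTopology Y) AddCommGrpCat.{u}

instance : (sheafify Y).Additive :=
  inferInstanceAs (presheafToSheaf (Opens.grothendieckTopology Y) AddCommGrpCat.{u}).Additive

variable {P Q : (Opens Y)ᵒᵖ ⥤ AddCommGrpCat.{u}}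

/-- The section of the sheafification represented by a section of the presheaf. -/
noncomputable def toSec {V : Opens Y} : P.obj (op V) →+ Sec ((sheafify Y).obj P) V :=
  ((toSheafify (Opens.grothendieckTopology Y) P).app (op V)).hom

theorem res_toSec {V W : Opens Y} (h : W ≤ V) (p : P.obj (op V)) :
    res h (toSec p) = toSec (P.map (homOfLE h).op p) :=
  (NatTrans.naturality_apply (toSheafify (Opens.grothendieckTopology Y) P) (homOfLE h).op p).symm

theorem app_toSec (φ : P ⟶ Q) {V : Opens Y} (p : P.obj (op V)) :
    app ((sheafify Y).map φ) V (toSec p) = toSec (φ.app (op V) p) :=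
  (ConcreteCategory.congr_hom (NatTrans.congr_app
    (toSheafify_naturality (Opens.grothendieckTopology Y) φ) (op V)) p).symm

theorem exists_toSec {V : Opens Y} (t : Sec ((sheafify Y).obj P) V) {y : Y} (hy : y ∈ V) :
    ∃ (W : Opens Y) (hW : W ≤ V) (p : P.obj (op W)), y ∈ W ∧ toSec p = res hW t := by
  have : TopCat.Presheaf.IsLocallySurjective (toSheafify (Opens.grothendieckTopology Y) P) :=
    inferInstanceAs (CategoryTheory.Presheaf.IsLocallySurjective (Opens.grothendieckTopology Y)
      (toSheafify (Opens.grothendieckTopology Y) P))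
  obtain ⟨W, hW, ⟨p, hp⟩, hyW⟩ := (TopCat.Presheaf.isLocallySurjective_iff _).mp this V t y hy
  exact ⟨W, hW, p, hyW, hp⟩

theorem exists_map_eq_of_toSec_eq {V : Opens Y} {p q : P.obj (op V)}
    (h : toSec p = toSec q) {y : Y} (hy : y ∈ V) :
    ∃ (W : Opens Y) (hW : W ≤ V), y ∈ W ∧ P.map (homOfLE hW).op p = P.map (homOfLE hW).op q := by
  obtain ⟨W, i, hi, hW⟩ := CategoryTheory.Presheaf.equalizerSieve_mem
    (Opens.grothendieckTopology Y) (toSheafify (Opens.grothendieckTopology Y) P) p q h y hy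
  exact ⟨W, i.le, hW, hi⟩

end Sheafification

variable {M N K : AbSh Y} {V W : Opens Y}

section FiniteFunctions

/-- The group of functions `V → M(V)` with finitely many values. -/
def finFun (M : AbSh Y) (V : Opens Y) : AddSubgroup (V → Sec M V) where
  carrier := {p | (Set.range p).Finite}
  zero_mem' := (Set.finite_singleton 0).subset (by rintro _ ⟨y, rfl⟩; rfl)
  add_mem' {p q} hp hq := (hp.add hq).subset (by
    rintro _ ⟨y, rfl⟩
    exact Set.add_mem_add ⟨y, rfl⟩ ⟨y, rfl⟩)
  neg_mem' {p} hp := (hp.neg).subset (by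
    rintro _ ⟨y, rfl⟩
    exact Set.neg_mem_neg.mpr ⟨y, rfl⟩)

/-- Restriction of functions with finitely many values. -/
noncomputable def finRes (h : W ≤ V) : finFun M V →+ finFun M W where
  toFun p := ⟨fun y ↦ res h (p.1 ⟨y.1, h y.2⟩), (p.2.image (res h)).subset (by
    rintro _ ⟨y, rfl⟩
    exact ⟨_, ⟨_, rfl⟩, rfl⟩)⟩
  map_zero' := Subtype.ext (funext fun _ ↦ map_zero _)
  map_add' _ _ := Subtype.ext (funext fun _ ↦ map_add _ _ _)

theorem finRes_apply (h : W ≤ V) (p : finFun M V) (y : W) :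
    (finRes h p).1 y = res h (p.1 ⟨y.1, h y.2⟩) := rfl

/-- The presheaf `V ↦ finFun M V`. -/
noncomputable def finPresheaf (M : AbSh Y) : (Opens Y)ᵒᵖ ⥤ AddCommGrpCat.{u} where
  obj V := AddCommGrpCat.of (finFun M V.unop)
  map i := AddCommGrpCat.ofHom (finRes i.unop.le)
  map_id V := by
    refine ConcreteCategory.hom_ext _ _ fun (p : finFun M V.unop) ↦ ?_
    exact Subtype.ext (funext fun y ↦ res_self le_rfl (p.1 y))
  map_comp {V _ _} i j := by
    refine ConcreteCategory.hom_ext _ _ fun (p : finFun M V.unop) ↦ ?_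
    exact Subtype.ext (funext fun y ↦ (res_res i.unop.le j.unop.le (p.1 _)).symm)

/-- Postcomposition of functions with finitely many values with a morphism of sheaves. -/
noncomputable def finFunMap (φ : M ⟶ N) (V : Opens Y) : finFun M V →+ finFun N V where
  toFun p := ⟨fun y ↦ app φ V (p.1 y), (p.2.image (app φ V)).subset (by
    rintro _ ⟨y, rfl⟩
    exact ⟨_, ⟨_, rfl⟩, rfl⟩)⟩
  map_zero' := Subtype.ext (funext fun _ ↦ map_zero _)
  map_add' _ _ := Subtype.ext (funext fun _ ↦ map_add _ _ _)

/-- The functor `M ↦ finPresheaf M`. -/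
noncomputable def finPresheafFunctor (Y : TopCat.{u}) : AbSh Y ⥤ (Opens Y)ᵒᵖ ⥤ AddCommGrpCat.{u} where
  obj M := finPresheaf M
  map φ :=
    { app := fun V ↦ AddCommGrpCat.ofHom (finFunMap φ V.unop)
      naturality := fun V W i ↦ by
        ext p
        exact Subtype.ext (funext fun y ↦ app_res φ i.unop.le _) }
  map_id _ := rfl
  map_comp _ _ := rfl

instance : (finPresheafFunctor Y).Additive where
  map_add := rfl

/-- The functor `M ↦ M ⊗ B`, where `B` is the sheaf of integer valued functions that locally have
finitely many values: it sends `M` to the sheafification of `finPresheaf M`. -/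
noncomputable def finSheaf (Y : TopCat.{u}) : AbSh Y ⥤ AbSh Y :=
  finPresheafFunctor Y ⋙ sheafify Y

instance : (finSheaf Y).Additive :=
  inferInstanceAs (finPresheafFunctor Y ⋙ sheafify Y).Additive

/-- The section of `finSheaf Y` represented by a function. -/
noncomputable def finSec : finFun M V →+ Sec ((finSheaf Y).obj M) V :=
  toSec (P := finPresheaf M)

theorem res_finSec (h : W ≤ V) (p : finFun M V) : res h (finSec p) = finSec (finRes h p) :=
  res_toSec (P := finPresheaf M) h p

theorem app_finSheaf_map (φ : M ⟶ N) (p : finFun M V) :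
    app ((finSheaf Y).map φ) V (finSec p) = finSec (finFunMap φ V p) :=
  app_toSec ((finPresheafFunctor Y).map φ) p

theorem exists_finSec (t : Sec ((finSheaf Y).obj M) V) {y : Y} (hy : y ∈ V) :
    ∃ (W : Opens Y) (hW : W ≤ V) (p : finFun M W), y ∈ W ∧ finSec p = res hW t :=
  exists_toSec (P := finPresheaf M) t hy

theorem exists_finRes_eq_zero {p : finFun M V} (h : finSec p = 0) {y : Y} (hy : y ∈ V) :
    ∃ (W : Opens Y) (hW : W ≤ V), y ∈ W ∧ finRes hW p = 0 := by
  obtain ⟨W, hW, hyW, h⟩ := exists_map_eq_of_toSec_eq (P := finPresheaf M) (p := p) (q := 0)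
    (h.trans (map_zero finSec).symm) hy
  exact ⟨W, hW, hyW, h.trans (map_zero (finRes hW))⟩

/-- Finitely many local properties hold simultaneously on a neighborhood. -/
theorem exists_common_opens {α : Type*} {S : Set α} (hS : S.Finite) {V : Opens Y} {y : Y}
    (hy : y ∈ V) (Q : α → Opens Y → Prop) (hQ : ∀ a W W', W' ≤ W → Q a W → Q a W')
    (h : ∀ a ∈ S, ∃ W, y ∈ W ∧ Q a W) : ∃ W ≤ V, y ∈ W ∧ ∀ a ∈ S, Q a W := by
  induction S, hS using Set.Finite.induction_on with
  | empty => exact ⟨V, le_rfl, hy, by simp⟩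
  | @insert a S _ _ ih =>
    obtain ⟨W, hWV, hyW, hW⟩ := ih fun b hb ↦ h b (Set.mem_insert_of_mem _ hb)
    obtain ⟨W', hyW', hW'⟩ := h a (Set.mem_insert _ _)
    refine ⟨W ⊓ W', inf_le_left.trans hWV, ⟨hyW, hyW'⟩, fun b hb ↦ ?_⟩
    rcases hb with rfl | hb
    · exact hQ _ _ _ inf_le_right hW'
    · exact hQ _ _ _ inf_le_left (hW b hb)

/-- Finiteness of the range is essential: every value lifts on some neighborhood of `y`, and
finitely many neighborhoods have a common refinement. -/
theorem finSheaf_map_exact (S : ShortComplex (AbSh Y)) (hS : S.Exact) :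
    (S.map (finSheaf Y)).Exact := by
  rw [exact_iff] at hS ⊢
  intro V (s : Sec ((finSheaf Y).obj S.X₂) V) (hs : app ((finSheaf Y).map S.g) V s = 0) y hy
  obtain ⟨W, hW, p, hyW, hp⟩ := exists_finSec s hy
  have hp0 : finSec (finFunMap S.g W p) = 0 := by
    rw [← app_finSheaf_map, hp, app_res, hs, map_zero]
  obtain ⟨W', hW', hyW', h0⟩ := exists_finRes_eq_zero hp0 hyW
  have h0' : ∀ z : W', app S.g W' ((finRes hW' p).1 z) = 0 := fun z ↦ by
    rw [finRes_apply, app_res]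
    exact congrFun (congrArg Subtype.val h0) z
  obtain ⟨O, hO, hyO, h⟩ := exists_common_opens (finRes hW' p).2 hyW'
    (fun m O ↦ ∃ (hO : O ≤ W') (t : Sec S.X₁ O), app S.f O t = res hO m)
    (by
      rintro m O O' hO ⟨hOW, t, ht⟩
      exact ⟨hO.trans hOW, res hO t, by rw [app_res, ht, res_res]⟩)
    (by
      rintro _ ⟨z, rfl⟩
      obtain ⟨O, hO, hyO, t, ht⟩ := hS W' _ (h0' z) y hyW'
      exact ⟨O, hyO, hO, t, ht⟩)
  have h' : ∀ m : Sec S.X₂ W', ∃ t : Sec S.X₁ O, m ∈ Set.range (finRes hW' p).1 →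
      app S.f O t = res hO m := fun m ↦ by
    by_cases hm : m ∈ Set.range (finRes hW' p).1
    · obtain ⟨hO, t, ht⟩ := h m hm
      exact ⟨t, fun _ ↦ ht⟩
    · exact ⟨0, fun hm' ↦ absurd hm' hm⟩
  choose a ha using h'
  refine ⟨O, hO.trans (hW'.trans hW), hyO, (finSec (M := S.X₁) ⟨fun z ↦ a ((finRes hW' p).1 ⟨z.1, hO z.2⟩),
    ((finRes hW' p).2.image a).subset ?_⟩ : Sec ((finSheaf Y).obj S.X₁) O), ?_⟩
  · rintro _ ⟨z, rfl⟩
    exact ⟨_, ⟨_, rfl⟩, rfl⟩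
  · refine (app_finSheaf_map S.f _).trans ?_
    have : res (hO.trans (hW'.trans hW)) s = finSec (finRes (hO.trans hW') p) := by
      rw [← res_finSec, hp, res_res]
    refine Eq.trans ?_ this.symm
    congr 1
    refine Subtype.ext (funext fun z ↦ (ha _ ⟨_, rfl⟩).trans ?_)
    rw [finRes_apply, finRes_apply, res_res]

instance : PreservesFiniteLimits (finSheaf Y) :=
  ((finSheaf Y).exact_tfae.out 1 3 rfl rfl).mp finSheaf_map_exact |>.1

instance : PreservesFiniteColimits (finSheaf Y) :=
  ((finSheaf Y).exact_tfae.out 1 3 rfl rfl).mp finSheaf_map_exact |>.2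

/-- A local section takes finitely many values, so the union of the finite index sets needed for
them works on one common neighborhood. -/
theorem finSheaf_isLocalResolution {J : Type u} {e : J → (N ⟶ N)} (he : IsLocalResolution e) :
    IsLocalResolution (fun a ↦ (finSheaf Y).map (e a)) := by
  classical
  intro V t y hy
  obtain ⟨W, hW, p, hyW, hp⟩ := exists_finSec t hy
  obtain ⟨O, hO, hyO, h⟩ := exists_common_opens p.2 hyW
    (fun m O ↦ ∃ (hO : O ≤ W) (S : Finset J), ∀ S', S ⊆ S' →
      ∑ a ∈ S', app (e a) O (res hO m) = res hO m)
    (by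
      rintro m O O' hO ⟨hOW, S, hS⟩
      refine ⟨hO.trans hOW, S, fun S' hS' ↦ ?_⟩
      have := congrArg (res hO) (hS S' hS')
      simpa only [map_sum, ← app_res, res_res] using this)
    (by
      rintro m -
      obtain ⟨O, hO, S, hyO, h⟩ := he W m y hyW
      exact ⟨O, hyO, hO, S, h⟩)
  have h' : ∀ m : Sec N W, ∃ S : Finset J, m ∈ Set.range p.1 → ∀ S', S ⊆ S' →
      ∑ a ∈ S', app (e a) O (res hO m) = res hO m := fun m ↦ by
    by_cases hm : m ∈ Set.range p.1
    · obtain ⟨hO, S, hS⟩ := h m hm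
      exact ⟨S, fun _ ↦ hS⟩
    · exact ⟨∅, fun hm' ↦ absurd hm' hm⟩
  choose σ hσ using h'
  refine ⟨O, hO.trans hW, p.2.toFinset.biUnion σ, hyO, fun S' hS' ↦ ?_⟩
  have ht : res (hO.trans hW) t = finSec (finRes hO p) := by rw [← res_finSec, hp, res_res]
  rw [ht]
  simp only [app_finSheaf_map]
  rw [← map_sum]
  congr 1
  refine Subtype.ext (funext fun z ↦ ?_)
  rw [AddSubgroup.val_finsetSum, Finset.sum_apply]
  refine hσ (p.1 ⟨z.1, hO z.2⟩) ⟨_, rfl⟩ S' ((Finset.subset_biUnion_of_mem σ ?_).trans hS')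
  exact (Set.Finite.mem_toFinset _).mpr ⟨_, rfl⟩

instance (J : Type u) : PreservesColimitsOfShape (Discrete J) (finSheaf Y) :=
  preservesCoproducts_of_isLocalResolution _ J fun _ _ h ↦ finSheaf_isLocalResolution h

instance : PreservesColimits (finSheaf Y) :=
  preservesColimits_of_shortExact (finSheaf Y) fun S hS ↦ by
    have := hS.epi_g
    infer_instance

/-- The constant function attached to a section. -/
def finConst : Sec M V →+ finFun M V where
  toFun s := ⟨fun _ ↦ s, (Set.finite_singleton s).subset (by rintro _ ⟨y, rfl⟩; rfl)⟩
  map_zero' := rfl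
  map_add' _ _ := rfl

/-- The morphism sending a section to the corresponding constant function. -/
noncomputable def toFinSheaf (Y : TopCat.{u}) : 𝟭 (AbSh Y) ⟶ finSheaf Y where
  app M := homMk (M := M) (N := (finSheaf Y).obj M) (fun _ ↦ finSec.comp finConst)
    (fun _ _ h s ↦ (res_finSec h (finConst s)).symm)
  naturality M _ φ := hom_ext fun _ (s : Sec M _) ↦ (app_finSheaf_map φ (finConst s)).symm

instance (M : AbSh Y) : Mono ((toFinSheaf Y).app M) := by
  rw [mono_iff_injective]
  intro V
  rw [injective_iff_map_eq_zero]
  intro (s : Sec M V) (hs : finSec (finConst s) = 0)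
  refine sec_ext (N := M) fun y hy ↦ ?_
  obtain ⟨W, hW, hyW, h⟩ := exists_finRes_eq_zero hs hy
  exact ⟨W, hW, hyW, (congrFun (congrArg Subtype.val h) ⟨y, hyW⟩).trans (map_zero _).symm⟩

open Classical in
/-- Multiplication by the characteristic function of a subset. -/
theorem exists_finSheaf_indicator (M : AbSh Y) (E : Set Y) :
    ∃ χ : (finSheaf Y).obj M ⟶ (finSheaf Y).obj M,
      (∀ (V : Opens Y) (s : Sec ((finSheaf Y).obj M) V), Disjoint (V : Set Y) E → app χ V s = 0) ∧
      ∀ (V : Opens Y) (s : Sec ((finSheaf Y).obj M) V), (V : Set Y) ⊆ E → app χ V s = s := by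
  -- Cutting off along an arbitrary set adds at most the value `0` and commutes with restriction, so
  -- it descends to the sheafification without topological conditions on `E`.
  let χ₀ (V : Opens Y) : finFun M V →+ finFun M V :=
    { toFun := fun p ↦ ⟨fun y ↦ if y.1 ∈ E then p.1 y else 0, (p.2.insert 0).subset (by
        rintro _ ⟨y, rfl⟩
        dsimp only
        split_ifs
        · exact Or.inr ⟨y, rfl⟩
        · exact Or.inl rfl)⟩
      map_zero' := Subtype.ext (funext fun y ↦ ite_self _)
      map_add' := fun p q ↦ Subtype.ext (funext fun y ↦ by
        change (if y.1 ∈ E then p.1 y + q.1 y else 0) =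
          (if y.1 ∈ E then p.1 y else 0) + (if y.1 ∈ E then q.1 y else 0)
        split_ifs
        · rfl
        · rw [add_zero]) }
  have hχ₀ (V W : Opens Y) (h : W ≤ V) (p : finFun M V) :
      χ₀ W (finRes h p) = finRes h (χ₀ V p) := Subtype.ext (funext fun y ↦ by
    change (if y.1 ∈ E then res h (p.1 ⟨y.1, h y.2⟩) else 0) =
      res h (if y.1 ∈ E then p.1 ⟨y.1, h y.2⟩ else 0)
    split_ifs
    · rfl
    · rw [map_zero])
  let ψ : finPresheaf M ⟶ finPresheaf M :=
    { app := fun V ↦ AddCommGrpCat.ofHom (χ₀ V.unop)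
      naturality := fun V W i ↦ by
        ext p
        exact hχ₀ V.unop W.unop i.unop.le p }
  let χ : (finSheaf Y).obj M ⟶ (finSheaf Y).obj M := (sheafify Y).map ψ
  have hψ (V : Opens Y) (p : finFun M V) :
      app χ V (finSec p) =
        finSec (χ₀ V p) := app_toSec ψ p
  refine ⟨χ, fun V s hV ↦ sec_ext fun y hy ↦ ?_, fun V s hV ↦ sec_ext fun y hy ↦ ?_⟩
  · obtain ⟨W, hW, p, hyW, hp⟩ := exists_finSec s hy
    refine ⟨W, hW, hyW, ?_⟩
    rw [← app_res, ← hp, hψ, map_zero, ← map_zero finSec]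
    congr 1
    exact Subtype.ext (funext fun z ↦ if_neg fun hz ↦ Set.disjoint_left.mp hV (hW z.2) hz)
  · obtain ⟨W, hW, p, hyW, hp⟩ := exists_finSec s hy
    refine ⟨W, hW, hyW, ?_⟩
    rw [← app_res, ← hp, hψ]
    congr 1
    exact Subtype.ext (funext fun z ↦ if_pos (hV (hW z.2)))

end FiniteFunctions

end AbSheaf

/-! ### Subsets that are proper over the base -/

namespace MapsProperly

variable {Y X : Type*} [TopologicalSpace Y] [TopologicalSpace X] {f : Y → X} {P Q W : Set Y}
  {U U' : Set X} {x : X}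

theorem restrict (hf : Continuous f) (h : MapsProperly f P U) (hU : U' ⊆ U) :
    MapsProperly f (P ∩ f ⁻¹' U') U' := by
  rw [mapsProperly_iff hf] at h ⊢
  refine ⟨fun y hy ↦ hy.2, fun 𝒰 h𝒰 x hx hlim ↦ ?_⟩
  obtain ⟨y, hy, rfl, hle⟩ := h.2 𝒰 (Filter.mem_of_superset h𝒰 Set.inter_subset_left) x (hU hx) hlim
  exact ⟨y, ⟨hy, hx⟩, rfl, hle⟩

theorem union (hf : Continuous f) (hP : MapsProperly f P U) (hQ : MapsProperly f Q U) :
    MapsProperly f (P ∪ Q) U := by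
  rw [mapsProperly_iff hf] at hP hQ ⊢
  refine ⟨hP.1.union hQ.1, fun 𝒰 h𝒰 x hx hlim ↦ ?_⟩
  rcases Ultrafilter.union_mem_iff.mp h𝒰 with h | h
  · obtain ⟨y, hy, h⟩ := hP.2 𝒰 h x hx hlim
    exact ⟨y, Or.inl hy, h⟩
  · obtain ⟨y, hy, h⟩ := hQ.2 𝒰 h x hx hlim
    exact ⟨y, Or.inr hy, h⟩

theorem empty (hf : Continuous f) (U : Set X) : MapsProperly f ∅ U :=
  (mapsProperly_iff hf).mpr ⟨Set.mapsTo_empty _ _, fun 𝒰 h ↦ absurd h 𝒰.empty_notMem⟩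

theorem isCompact_fiber (hf : Continuous f) (h : MapsProperly f P U) (hx : x ∈ U) :
    IsCompact (P ∩ f ⁻¹' {x}) := by
  rw [mapsProperly_iff hf] at h
  rw [isCompact_iff_ultrafilter_le_nhds]
  intro 𝒰 h𝒰
  rw [Filter.le_principal_iff] at h𝒰
  obtain ⟨y, hy, hyx, hle⟩ := h.2 𝒰 (Filter.mem_of_superset h𝒰 Set.inter_subset_left) x hx
    (tendsto_nhds_of_eventually_eq (Filter.mem_of_superset h𝒰 fun _ h ↦ h.2))
  exact ⟨y, ⟨hy, hyx⟩, hle⟩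

/-- Tube lemma: a proper set that is contained in an open set `W` on a fiber is contained in `W`
near that fiber. -/
theorem exists_tube (hf : Continuous f) (h : MapsProperly f P U) (hx : x ∈ U) (hW : IsOpen W)
    (hPW : P ∩ f ⁻¹' {x} ⊆ W) : ∃ O : Set X, IsOpen O ∧ x ∈ O ∧ P ∩ f ⁻¹' O ⊆ W := by
  rw [mapsProperly_iff hf] at h
  -- Otherwise some ultrafilter on `P \ W` lies over `x`; properness makes it converge to a point of
  -- `P` in the fiber, which has `W` as a neighborhood.
  have hbot : Filter.comap f (𝓝 x) ⊓ Filter.principal (P \ W) = ⊥ := by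
    by_contra hne
    have : (Filter.comap f (𝓝 x) ⊓ Filter.principal (P \ W)).NeBot := ⟨hne⟩
    obtain ⟨𝒰, h𝒰⟩ := Ultrafilter.exists_le (Filter.comap f (𝓝 x) ⊓ Filter.principal (P \ W))
    have hPW' : P \ W ∈ 𝒰 := Filter.le_principal_iff.mp (h𝒰.trans inf_le_right)
    obtain ⟨y, hy, hyx, hle⟩ := h.2 𝒰 (Filter.mem_of_superset hPW' Set.sdiff_subset) x hx
      (Filter.tendsto_iff_comap.mpr (h𝒰.trans inf_le_left))
    obtain ⟨z, hz, hz'⟩ := 𝒰.nonempty_of_mem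
      (Filter.inter_mem hPW' (hle (hW.mem_nhds (hPW ⟨hy, hyx⟩))))
    exact hz.2 hz'
  rw [Filter.inf_principal_eq_bot, Filter.mem_comap] at hbot
  obtain ⟨N, hN, hNW⟩ := hbot
  obtain ⟨O, hON, hO, hxO⟩ := mem_nhds_iff.mp hN
  refine ⟨O, hO, hxO, fun y hy ↦ ?_⟩
  by_contra hyW
  exact hNW (hON hy.2) ⟨hy.1, hyW⟩

end MapsProperly

/-! ### Separated and locally proper maps -/

section Separated

variable {Y X : Type*} [TopologicalSpace Y] {f : Y → X} {P W : Set Y}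
  {U : Set X} {x : X} {C D : Set Y}

theorem IsSeparatedMap.eq_of_ultrafilter_le (hsep : IsSeparatedMap f) {𝒰 : Ultrafilter Y} {y z : Y}
    (hyz : f y = f z) (hy : (𝒰 : Filter Y) ≤ 𝓝 y) (hz : (𝒰 : Filter Y) ≤ 𝓝 z) : y = z := by
  by_contra hne
  obtain ⟨A, B, hA, hB, hyA, hzB, hAB⟩ := hsep y z hyz hne
  obtain ⟨w, hw, hw'⟩ := 𝒰.nonempty_of_mem
    (Filter.inter_mem (hy (hA.mem_nhds hyA)) (hz (hB.mem_nhds hzB)))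
  exact Set.disjoint_left.mp hAB hw hw'

theorem IsSeparatedMap.isCompact_inter (hsep : IsSeparatedMap f) (hC : IsCompact C)
    (hD : IsCompact D) (hCx : C ⊆ f ⁻¹' {x}) (hDx : D ⊆ f ⁻¹' {x}) : IsCompact (C ∩ D) := by
  rw [isCompact_iff_ultrafilter_le_nhds] at hC hD ⊢
  intro 𝒰 h𝒰
  obtain ⟨y, hy, hle⟩ := hC 𝒰 (h𝒰.trans (Filter.principal_mono.mpr Set.inter_subset_left))
  obtain ⟨z, hz, hle'⟩ := hD 𝒰 (h𝒰.trans (Filter.principal_mono.mpr Set.inter_subset_right))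
  have hyz : y = z := hsep.eq_of_ultrafilter_le ((hCx hy).trans (hDx hz).symm) hle hle'
  exact ⟨y, ⟨hy, hyz ▸ hz⟩, hle⟩

theorem IsSeparatedMap.separatedNhds (hsep : IsSeparatedMap f) (hC : IsCompact C)
    (hD : IsCompact D) (hCx : C ⊆ f ⁻¹' {x}) (hDx : D ⊆ f ⁻¹' {x}) (hCD : Disjoint C D) :
    SeparatedNhds C D := by
  rw [separatedNhds_iff_disjoint, hC.disjoint_nhdsSet_left]
  intro y hy
  rw [hD.disjoint_nhdsSet_right]
  intro z hz
  obtain ⟨A, B, hA, hB, hyA, hzB, hAB⟩ := hsep y z ((hCx hy).trans (hDx hz).symm)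
    (fun h ↦ Set.disjoint_left.mp hCD hy (h ▸ hz))
  exact Filter.disjoint_of_disjoint_of_mem hAB (hA.mem_nhds hyA) (hB.mem_nhds hzB)

variable [TopologicalSpace X]

/-- An ultrafilter on `P` converging to `y` over `U` also converges, by properness, to a point of
`P` in the fiber of `y`; separatedness makes the two limits equal. -/
theorem MapsProperly.isOpen_diff (hf : Continuous f) (hsep : IsSeparatedMap f)
    (h : MapsProperly f P U) (hU : IsOpen U) : IsOpen (f ⁻¹' U \ P) := by
  rw [mapsProperly_iff hf] at h
  rw [isOpen_iff_ultrafilter]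
  intro y hy 𝒰 hle
  rw [← Ultrafilter.mem_coe, Set.sdiff_eq]
  refine Filter.inter_mem (hle ((hU.preimage hf).mem_nhds hy.1)) ?_
  rw [Ultrafilter.mem_coe, Ultrafilter.compl_mem_iff_notMem]
  intro hP
  obtain ⟨z, hz, hzy, hle'⟩ := h.2 𝒰 hP (f y) hy.1 ((hf.tendsto y).mono_left hle)
  exact hy.2 (hsep.eq_of_ultrafilter_le hzy hle' hle ▸ hz)

/-- A compact subset of a fiber of a locally proper map has arbitrarily small neighborhoods that
are proper over a neighborhood of the base point. -/
theorem IsLocallyProperMap.exists_mapsProperly (hlp : IsLocallyProperMap f) (hC : IsCompact C)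
    (hCx : C ⊆ f ⁻¹' {x})
    (hW : IsOpen W) (hCW : C ⊆ W) (hU : IsOpen U) (hx : x ∈ U) :
    ∃ (O : Set X) (P : Set Y), IsOpen O ∧ x ∈ O ∧ O ⊆ U ∧ P ⊆ W ∧ MapsProperly f P O ∧
      C ⊆ interior P := by
  have hf := hlp.1
  rw [← Set.inter_eq_left.mpr hCx]
  refine hC.induction_on (p := fun t ↦ ∃ (O : Set X) (P : Set Y), IsOpen O ∧ x ∈ O ∧ O ⊆ U ∧ P ⊆ W ∧
    MapsProperly f P O ∧ t ∩ f ⁻¹' {x} ⊆ interior P) ?_ ?_ ?_ ?_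
  · exact ⟨U, ∅, hU, hx, subset_rfl, Set.empty_subset _, .empty hf _, by simp⟩
  · rintro s t hst ⟨O, P, hO, hxO, hOU, hPW, hP, ht⟩
    exact ⟨O, P, hO, hxO, hOU, hPW, hP, (Set.inter_subset_inter_left _ hst).trans ht⟩
  · rintro s t ⟨O, P, hO, hxO, hOU, hPW, hP, hs⟩ ⟨O', P', hO', hxO', -, hPW', hP', ht⟩
    refine ⟨O ∩ O', P ∩ f ⁻¹' (O ∩ O') ∪ P' ∩ f ⁻¹' (O ∩ O'), hO.inter hO', ⟨hxO, hxO'⟩,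
      Set.inter_subset_left.trans hOU,
      Set.union_subset (Set.inter_subset_left.trans hPW) (Set.inter_subset_left.trans hPW'),
      (hP.restrict hf Set.inter_subset_left).union hf (hP'.restrict hf Set.inter_subset_right), ?_⟩
    have hpre : IsOpen (f ⁻¹' (O ∩ O')) := (hO.inter hO').preimage hf
    rintro y ⟨hy | hy, rfl⟩
    · refine interior_mono Set.subset_union_left ?_
      rw [interior_inter, hpre.interior_eq]
      exact ⟨hs ⟨hy, rfl⟩, hxO, hxO'⟩
    · refine interior_mono Set.subset_union_right ?_
      rw [interior_inter, hpre.interior_eq]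
      exact ⟨ht ⟨hy, rfl⟩, hxO, hxO'⟩
  · intro y hy
    obtain rfl : f y = x := hCx hy
    obtain ⟨A, hA, hAW, B, hB, hAB⟩ := hlp.2 y W (hW.mem_nhds (hCW hy))
    refine ⟨interior A, mem_nhdsWithin_of_mem_nhds (interior_mem_nhds.mpr hA), interior B ∩ U,
      A ∩ f ⁻¹' (interior B ∩ U), isOpen_interior.inter hU, ⟨mem_interior_iff_mem_nhds.mpr hB, hx⟩,
      Set.inter_subset_right, Set.inter_subset_left.trans hAW,
      hAB.restrict hf (Set.inter_subset_left.trans interior_subset), ?_⟩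
    rintro z ⟨hz, hzy⟩
    rw [interior_inter, ((isOpen_interior.inter hU).preimage hf).interior_eq]
    refine ⟨hz, ?_⟩
    rw [Set.mem_preimage, show f z = f y from hzy]
    exact ⟨mem_interior_iff_mem_nhds.mpr hB, hx⟩

end Separated

/-! ### Sheaves that are soft relative to the map -/

namespace AbSheaf

open Limits
variable {Y X : TopCat.{u}} {f : Y ⟶ X} {M N K : AbSh Y} {V W : Opens Y} {U U' : Opens X}

/-- The preimage of an open set. -/
abbrev pre (f : Y ⟶ X) (U : Opens X) : Opens Y := (Opens.map f).obj U

theorem pre_mono (h : U' ≤ U) : pre f U' ≤ pre f U := fun _ hy ↦ h hy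

/-- The support is closed in the preimage of `U`, and a relatively closed subset of a proper set is
proper. -/
theorem mapsProperly_supp_of_subset {P : Set Y} {s : Sec N (pre f U)}
    (hP : MapsProperly f P U) (hs : supp s ⊆ P) : MapsProperly f (supp s) U := by
  rw [mapsProperly_iff f.hom.continuous] at hP ⊢
  refine ⟨fun y hy ↦ hP.1 (hs hy), fun 𝒰 h x hx hlim ↦ ?_⟩
  obtain ⟨y, hy, hyx, hle⟩ := hP.2 𝒰 (Filter.mem_of_superset h hs) x hx hlim
  exact ⟨y, mem_sectionSupport_of_ultrafilter (hP.1 hy) hle h, hyx, hle⟩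

/-- A sheaf on `Y` is `f`-soft if sections near a compact subset of a fiber extend, after shrinking
to a smaller neighborhood, to sections with proper support over a neighborhood of the base point. -/
def IsSoft (f : Y ⟶ X) (M : AbSh Y) : Prop :=
  ∀ (x : X) (C : Set Y) (W : Opens Y), IsCompact C → C ⊆ f ⁻¹' {x} → C ⊆ W → ∀ s : Sec M W,
    ∃ (U : Opens X) (t : Sec M (pre f U)), x ∈ U ∧ MapsProperly f (supp t) U ∧
      ∃ (O : Opens Y) (h₁ : O ≤ W) (h₂ : O ≤ pre f U), C ⊆ O ∧ res h₂ t = res h₁ s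

theorem IsSoft.of_retract (hN : IsSoft f N) (r : M ⟶ N) (q : N ⟶ M) (h : r ≫ q = 𝟙 M) :
    IsSoft f M := by
  intro x C W hC hCx hCW s
  obtain ⟨U, t, hx, ht, O, h₁, h₂, hCO, hts⟩ := hN x C W hC hCx hCW (app r W s)
  refine ⟨U, app q _ t, hx, mapsProperly_supp_of_subset ht (supp_app_subset q t), O, h₁, h₂, hCO, ?_⟩
  rw [← app_res, hts, ← app_res, ← app_comp, h, app_id]

/-- The open complement of a proper set. -/
def compl (hsep : IsSeparatedMap f) {P : Set Y} (hP : MapsProperly f P U) : Opens Y :=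
  ⟨f ⁻¹' U \ P, hP.isOpen_diff f.hom.continuous hsep U.isOpen⟩

/-- Take a neighborhood `P` of `C` inside `W` that is proper over a neighborhood of `x`, multiply
the section by the characteristic function of `P`, and extend by zero. This is possible because `P`
is relatively closed, and nothing changes on the interior of `P`. -/
theorem isSoft_finSheaf (hsep : IsSeparatedMap f) (hlp : IsLocallyProperMap f) (M : AbSh Y) :
    IsSoft f ((finSheaf Y).obj M) := by
  intro x C W hC hCx hCW s
  obtain ⟨U₀, P, hU₀, hx, -, hPW, hP, hCP⟩ := hlp.exists_mapsProperly hC hCx W.isOpen hCW isOpen_univ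
    (Set.mem_univ x)
  let U : Opens X := ⟨U₀, hU₀⟩
  replace hP : MapsProperly f P U := hP
  obtain ⟨χ, hχ₀, hχ₁⟩ := exists_finSheaf_indicator M P
  let O := compl hsep hP
  have hs : ∀ y ∈ O, y ∉ supp (app χ _ (res (inf_le_left : W ⊓ pre f U ≤ W) s)) := by
    intro y hy hys
    have := hχ₀ (W ⊓ pre f U ⊓ O) (res (inf_le_left.trans inf_le_left) s)
      (Set.disjoint_left.mpr fun z hz hzP ↦ hz.2.2 hzP)
    rw [← res_res (inf_le_left : W ⊓ pre f U ≤ W) inf_le_left, app_res, res_eq_zero_iff] at this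
    exact (Set.eq_empty_iff_forall_notMem.mp this y) ⟨hys, supp_subset _ hys, hy⟩
  obtain ⟨t, ht, hts⟩ := exists_extend_zero (inf_le_right : W ⊓ pre f U ≤ pre f U)
    (app χ _ (res inf_le_left s)) O (fun y hy ↦ hy.1)
    (fun y hy ↦ by
      by_cases hyP : y ∈ P
      · exact Or.inl ⟨hPW hyP, hy⟩
      · exact Or.inr ⟨hy, hyP⟩) hs
  have htP : supp t ⊆ P := by
    intro y hy
    by_contra hyP
    exact hs y ⟨supp_subset t hy, hyP⟩ (hts ▸ hy)
  refine ⟨U, t, hx, mapsProperly_supp_of_subset hP htP, ⟨interior P, isOpen_interior⟩ ⊓ pre f U,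
    fun y hy ↦ hPW (interior_subset hy.1), inf_le_right, fun y hy ↦ ⟨hCP hy, ?_⟩, ?_⟩
  · change f y ∈ U
    rw [show f y = x from hCx hy]
    exact hx
  · have h : (⟨interior P, isOpen_interior⟩ ⊓ pre f U : Opens Y) ≤ W ⊓ pre f U :=
      fun y hy ↦ ⟨hPW (interior_subset hy.1), hy.2⟩
    rw [← res_res inf_le_right h, ht, ← app_res, res_res]
    exact hχ₁ _ _ (fun y hy ↦ interior_subset hy.1)

/-- An injective sheaf is a retract of the soft sheaf in which it embeds. -/
theorem isSoft_of_injective (hsep : IsSeparatedMap f) (hlp : IsLocallyProperMap f) (I : AbSh Y)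
    [Injective I] : IsSoft f I :=
  (isSoft_finSheaf hsep hlp I).of_retract ((toFinSheaf Y).app I)
    (Injective.factorThru (𝟙 I) ((toFinSheaf Y).app I)) (Injective.comp_factorThru _ _)

/-- Sections of the quotient of a sheaf by a soft sheaf lift near compact subsets of fibers. -/
theorem exists_lift_near_compact (hsep : IsSeparatedMap f) (hlp : IsLocallyProperMap f)
    {S : ShortComplex (AbSh Y)} (hS : S.ShortExact) (h₁ : IsSoft f S.X₁) {x : X} {C : Set Y}
    (hC : IsCompact C) (hCx : C ⊆ f ⁻¹' {x}) (hCW : C ⊆ W) (s : Sec S.X₃ W) :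
    ∃ (V : Opens Y) (hV : V ≤ W) (t : Sec S.X₂ V), C ⊆ V ∧ app S.g V t = res hV s := by
  have hf := f.hom.continuous
  have := hS.mono_f
  -- Compactness induction runs over arbitrary subsets `A`, whereas softness needs compact ones;
  -- hence the auxiliary compact `K` between `A ∩ C` and `C`.
  suffices h : ∃ K : Set Y, IsCompact K ∧ C ∩ C ⊆ K ∧ K ⊆ C ∧
      ∃ (V : Opens Y) (hV : V ≤ W) (t : Sec S.X₂ V), K ⊆ V ∧ app S.g V t = res hV s by
    obtain ⟨K, -, hCK, -, V, hV, t, hKV, ht⟩ := h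
    exact ⟨V, hV, t, fun y hy ↦ hKV (hCK ⟨hy, hy⟩), ht⟩
  refine hC.induction_on (p := fun A ↦ ∃ K : Set Y, IsCompact K ∧ A ∩ C ⊆ K ∧ K ⊆ C ∧
    ∃ (V : Opens Y) (hV : V ≤ W) (t : Sec S.X₂ V), K ⊆ V ∧ app S.g V t = res hV s) ?_ ?_ ?_ ?_
  · refine ⟨∅, isCompact_empty, by simp, Set.empty_subset _, ⊥, bot_le, 0, Set.empty_subset _, ?_⟩
    rw [map_zero]
    exact sec_ext fun y hy ↦ absurd hy (by simp)
  · rintro A B hAB ⟨K, hK, hBK, h⟩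
    exact ⟨K, hK, (Set.inter_subset_inter_left _ hAB).trans hBK, h⟩
  · rintro A₁ A₂ ⟨K₁, hK₁, hA₁, hKC₁, V₁, hV₁, t₁, hKV₁, ht₁⟩ ⟨K₂, hK₂, hA₂, hKC₂, V₂, hV₂, t₂, hKV₂, ht₂⟩
    -- Two lifts differ by a section `a` of the first sheaf. Softness extends `a` from near `K₁ ∩
    -- K₂` to `a'`, which corrects the second lift so that both agree on `O`.
    obtain ⟨a, ha⟩ := exists_app_f_eq hS.exact
      (res (inf_le_left : V₁ ⊓ V₂ ≤ V₁) t₁ - res (inf_le_right : V₁ ⊓ V₂ ≤ V₂) t₂)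
      (by rw [map_sub, app_res, app_res, ht₁, ht₂, res_res, res_res, sub_self])
    obtain ⟨U, a', hx, -, O, hO, hOU, hKO, haO⟩ := h₁ x (K₁ ∩ K₂) (V₁ ⊓ V₂)
      (hsep.isCompact_inter hK₁ hK₂ (hKC₁.trans hCx) (hKC₂.trans hCx))
      (Set.inter_subset_left.trans (hKC₁.trans hCx))
      (fun y hy ↦ ⟨hKV₁ hy.1, hKV₂ hy.2⟩) a
    obtain ⟨G₁, G₂, hG₁, hG₂, hKG₁, hKG₂, hG⟩ := hsep.separatedNhds (hK₁.diff O.isOpen)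
      (hK₂.diff O.isOpen) (Set.sdiff_subset.trans (hKC₁.trans hCx))
      (Set.sdiff_subset.trans (hKC₂.trans hCx))
      (Set.disjoint_left.mpr fun y hy hy' ↦ hy.2 (hKO ⟨hy.1, hy'.1⟩))
    -- Outside `O` the two compact sets are separated by `G₁` and `G₂`, so `B₁ ⊓ B₂` lies in `O`,
    -- where the corrected lifts agree.
    let B₁ : Opens Y := V₁ ⊓ (⟨G₁, hG₁⟩ ⊔ O)
    let B₂ : Opens Y := V₂ ⊓ pre f U ⊓ (⟨G₂, hG₂⟩ ⊔ O)
    have hB₁ : B₁ ≤ V₁ := inf_le_left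
    have hB₂ : B₂ ≤ V₂ := inf_le_left.trans inf_le_left
    have hB₂U : B₂ ≤ pre f U := inf_le_left.trans inf_le_right
    have hB : B₁ ⊓ B₂ ≤ O := by
      rintro y ⟨⟨-, hy₁ | hy₁⟩, ⟨-, hy₂ | hy₂⟩⟩
      · exact absurd hy₂ (Set.disjoint_left.mp hG hy₁)
      all_goals assumption
    obtain ⟨t, ht, ht'⟩ := exists_glue₂ (V := B₁ ⊔ B₂) le_sup_left le_sup_right (fun y hy ↦ hy)
      (res hB₁ t₁) (res hB₂ t₂ + app S.f _ (res hB₂U a')) (by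
        have h := congrArg (fun b ↦ app S.f _ (res hB b)) haO
        simp only [res_res] at h
        rw [app_res S.f _ a, ha] at h
        rw [map_add, ← app_res, res_res, res_res, res_res, h, map_sub, res_res, res_res,
          add_sub_cancel])
    refine ⟨K₁ ∪ K₂, hK₁.union hK₂, ?_, Set.union_subset hKC₁ hKC₂, B₁ ⊔ B₂,
      sup_le (hB₁.trans hV₁) (hB₂.trans hV₂), t, ?_, ?_⟩
    · rw [Set.union_inter_distrib_right]
      exact Set.union_subset_union hA₁ hA₂
    · rintro y (hy | hy)
      · refine Or.inl ⟨hKV₁ hy, ?_⟩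
        by_cases hyO : y ∈ O
        · exact Or.inr hyO
        · exact Or.inl (hKG₁ ⟨hy, hyO⟩)
      · refine Or.inr ⟨⟨hKV₂ hy, ?_⟩, ?_⟩
        · change f y ∈ U
          rw [show f y = x from hCx (hKC₂ hy)]
          exact hx
        by_cases hyO : y ∈ O
        · exact Or.inr hyO
        · exact Or.inl (hKG₂ ⟨hy, hyO⟩)
    · refine sec_ext fun y hy ↦ ?_
      rcases hy with hy | hy
      · refine ⟨B₁, le_sup_left, hy, ?_⟩
        rw [← app_res, ht, app_res, ht₁, res_res, res_res]
      · refine ⟨B₂, le_sup_right, hy, ?_⟩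
        rw [← app_res, ht', map_add, app_g_f, add_zero, app_res, ht₂, res_res, res_res]
  · intro y hy
    obtain ⟨V, hV, hyV, t, ht⟩ := (epi_iff_locallySurjective S.g).mp hS.epi_g W s y (hCW hy)
    have hyx : {y} ⊆ f ⁻¹' {x} := Set.singleton_subset_iff.mpr (hCx hy)
    obtain ⟨O, P, -, hxO, -, hPV, hP, hyP⟩ := hlp.exists_mapsProperly (isCompact_singleton (x := y))
      hyx V.isOpen (Set.singleton_subset_iff.mpr hyV) isOpen_univ (Set.mem_univ x)
    refine ⟨interior P, mem_nhdsWithin_of_mem_nhds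
      (isOpen_interior.mem_nhds (Set.singleton_subset_iff.mp hyP)), P ∩ f ⁻¹' {x} ∩ C,
      hsep.isCompact_inter (hP.isCompact_fiber hf hxO) hC Set.inter_subset_right hCx,
      fun z hz ↦ ⟨⟨interior_subset hz.1, hCx hz.2⟩, hz.2⟩, Set.inter_subset_right, V, hV, t,
      fun z hz ↦ hPV hz.1.1, ht⟩

/-- Lift the section near `C`, extend the lift by softness of the middle sheaf, and push it forward;
supports can only shrink. -/
theorem IsSoft.of_shortExact (hsep : IsSeparatedMap f) (hlp : IsLocallyProperMap f)
    {S : ShortComplex (AbSh Y)} (hS : S.ShortExact) (h₁ : IsSoft f S.X₁) (h₂ : IsSoft f S.X₂) :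
    IsSoft f S.X₃ := by
  intro x C W hC hCx hCW s
  obtain ⟨V, hV, t, hCV, ht⟩ := exists_lift_near_compact hsep hlp hS h₁ hC hCx hCW s
  obtain ⟨U, t', hx, ht', O, hO, hOU, hCO, h⟩ := h₂ x C V hC hCx hCV t
  refine ⟨U, app S.g _ t', hx, mapsProperly_supp_of_subset ht' (supp_app_subset _ _), O,
    hO.trans hV, hOU, hCO, ?_⟩
  rw [← app_res, h, app_res, ht, res_res]

end AbSheaf

/-! ### Exactness properties of the proper direct image -/

namespace AbSheaf

open Limits
variable {Y X : TopCat.{u}} {f : Y ⟶ X} {M N K : AbSh Y} {V W : Opens Y} {U U' : Opens X}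

/-- The section of `M` underlying a section of its proper direct image. -/
noncomputable def pdVal : Sec ((properDirectImage f).obj M) U →+ Sec M (pre f U) :=
  (properSections f M.obj U).subtype

/-- A section whose support is proper, as a section of the proper direct image. -/
def pdMk (s : Sec M (pre f U)) (hs : MapsProperly f (supp s) U) :
    Sec ((properDirectImage f).obj M) U :=
  (⟨s, hs⟩ : properSections f M.obj U)

@[simp]
theorem pdVal_pdMk (s : Sec M (pre f U)) (hs : MapsProperly f (supp s) U) : pdVal (pdMk s hs) = s :=
  rfl

theorem pdVal_injective : Function.Injective (pdVal (f := f) (M := M) (U := U)) :=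
  Subtype.val_injective

theorem mapsProperly_supp_pdVal (s : Sec ((properDirectImage f).obj M) U) :
    MapsProperly f (supp (pdVal s)) U :=
  Subtype.property (p := fun s ↦ s ∈ properSections f M.obj U) s

theorem pdVal_res (h : U' ≤ U) (s : Sec ((properDirectImage f).obj M) U) :
    pdVal (res h s) = res (pre_mono h) (pdVal s) := rfl

theorem pdVal_app (φ : M ⟶ N) (s : Sec ((properDirectImage f).obj M) U) :
    pdVal (app ((properDirectImage f).map φ) U s) = app φ (pre f U) (pdVal s) := rfl

theorem mono_properDirectImage_map (φ : M ⟶ N) [hφ : Mono φ] : Mono ((properDirectImage f).map φ) := by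
  rw [mono_iff_injective] at hφ ⊢
  intro U s t h
  apply pdVal_injective
  apply hφ
  rw [← pdVal_app, h, pdVal_app]

theorem mapsProperly_supp_of_app_mono (φ : M ⟶ N) [hφ : Mono φ] (s : Sec M (pre f U))
    (hs : MapsProperly f (supp (app φ _ s)) U) : MapsProperly f (supp s) U := by
  refine mapsProperly_supp_of_subset hs fun y hy ↦ ?_
  by_contra hn
  obtain ⟨W, hW, hyW, h⟩ := (not_mem_supp_iff (supp_subset s hy)).mp hn
  refine (not_mem_supp_iff (supp_subset s hy)).mpr ⟨W, hW, hyW, ?_⟩ hy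
  apply (mono_iff_injective φ).mp hφ W
  rw [app_res, h, map_zero]

instance : PreservesFiniteLimits (properDirectImage f) := by
  refine ((properDirectImage f).preservesFiniteLimits_tfae.out 1 3 rfl rfl).mp fun S hS ↦ ⟨?_, ?_⟩
  · refine exact_of_sections _ fun U (s : Sec ((properDirectImage f).obj S.X₂) U)
      (hs : app ((properDirectImage f).map S.g) U s = 0) ↦ ?_
    have := hS.2
    obtain ⟨t, ht⟩ := exists_app_f_eq hS.1 (pdVal s) (by rw [← pdVal_app, hs, map_zero])
    refine ⟨(pdMk t (mapsProperly_supp_of_app_mono S.f t (by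
      rw [ht]
      exact mapsProperly_supp_pdVal s)) : Sec ((properDirectImage f).obj S.X₁) U), ?_⟩
    exact pdVal_injective ht
  · have := hS.2
    exact mono_properDirectImage_map S.f

/-- The support meets the fiber in a compact set, so one finite index set works near all of it, and
the tube lemma spreads this over a neighborhood of the base point. -/
theorem properDirectImage_isLocalResolution {J : Type u} {e : J → (N ⟶ N)}
    (he : IsLocalResolution e) :
    IsLocalResolution (fun a ↦ (properDirectImage f).map (e a)) := by
  classical
  intro U s x hx
  have hs := mapsProperly_supp_pdVal s
  have hC := hs.isCompact_fiber f.hom.continuous hx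
  obtain ⟨W, hW, S, hCW, hS⟩ := hC.induction_on (p := fun A ↦ ∃ (W : Opens Y) (hW : W ≤ pre f U)
      (S : Finset J), A ∩ pre f U ⊆ W ∧ ∀ S', S ⊆ S' →
        ∑ a ∈ S', app (e a) W (res hW (pdVal s)) = res hW (pdVal s))
    ⟨⊥, bot_le, ∅, by simp, fun _ _ ↦ sec_ext fun y hy ↦ absurd hy (by simp)⟩
    (by
      rintro A B hAB ⟨W, hW, S, hBW, hS⟩
      exact ⟨W, hW, S, (Set.inter_subset_inter_left _ hAB).trans hBW, hS⟩)
    (by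
      rintro A B ⟨W₁, hW₁, S₁, hA, hS₁⟩ ⟨W₂, hW₂, S₂, hB, hS₂⟩
      refine ⟨W₁ ⊔ W₂, sup_le hW₁ hW₂, S₁ ∪ S₂, ?_, fun S' hS' ↦ sec_ext fun y hy ↦ ?_⟩
      · rw [Set.union_inter_distrib_right]
        exact Set.union_subset_union hA hB
      · rcases hy with hy | hy
        · refine ⟨W₁, le_sup_left, hy, ?_⟩
          simp only [map_sum, ← app_res, res_res]
          exact hS₁ S' (Finset.union_subset_left hS')
        · refine ⟨W₂, le_sup_right, hy, ?_⟩
          simp only [map_sum, ← app_res, res_res]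
          exact hS₂ S' (Finset.union_subset_right hS'))
    (by
      intro y hy
      obtain ⟨W, hW, S, hyW, hS⟩ := he (pre f U) (pdVal s) y (supp_subset _ hy.1)
      exact ⟨W, mem_nhdsWithin_of_mem_nhds (W.isOpen.mem_nhds hyW), W, hW, S,
        Set.inter_subset_left, hS⟩)
  obtain ⟨O, hO, hxO, hOW⟩ := hs.exists_tube f.hom.continuous hx W.isOpen
    (fun y hy ↦ hCW ⟨hy, supp_subset _ hy.1⟩)
  refine ⟨U ⊓ ⟨O, hO⟩, inf_le_left, S, ⟨hx, hxO⟩, fun S' hS' ↦ ?_⟩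
  apply pdVal_injective
  simp only [map_sum, pdVal_app, pdVal_res]
  refine sec_ext fun y hy ↦ ?_
  by_cases hys : y ∈ supp (pdVal s)
  · refine ⟨W ⊓ pre f (U ⊓ ⟨O, hO⟩), inf_le_right, ⟨hOW ⟨hys, hy.2⟩, hy⟩, ?_⟩
    have := congrArg (res (inf_le_left : W ⊓ pre f (U ⊓ ⟨O, hO⟩) ≤ W)) (hS S' hS')
    simpa only [map_sum, ← app_res, res_res] using this
  · obtain ⟨W', hW', hyW', h⟩ := (not_mem_supp_iff (V := pre f U) (y := y) hy.1).mp hys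
    refine ⟨W' ⊓ pre f (U ⊓ ⟨O, hO⟩), inf_le_right, ⟨hyW', hy⟩, ?_⟩
    have := congrArg (res (inf_le_left : W' ⊓ pre f (U ⊓ ⟨O, hO⟩) ≤ W')) h
    rw [res_res, map_zero] at this
    simp only [map_sum, ← app_res, res_res, this, map_zero, Finset.sum_const_zero]

instance (J : Type u) : PreservesColimitsOfShape (Discrete J) (properDirectImage f) :=
  preservesCoproducts_of_isLocalResolution _ J fun _ _ h ↦ properDirectImage_isLocalResolution h

/-- A lift near the compact fiber of the support need not have proper support. It is corrected by a
section of the soft sheaf so that it vanishes near the boundary of a proper neighborhood, and then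
extended by zero. -/
theorem epi_properDirectImage_map (hsep : IsSeparatedMap f) (hlp : IsLocallyProperMap f)
    {S : ShortComplex (AbSh Y)} (hS : S.ShortExact) (h₁ : IsSoft f S.X₁) :
    Epi ((properDirectImage f).map S.g) := by
  have hf := f.hom.continuous
  have := hS.mono_f
  rw [epi_iff_locallySurjective]
  intro U s' x hx
  obtain ⟨s, rfl⟩ : ∃ s : Sec S.X₃ (pre f U), s = pdVal s' := ⟨_, rfl⟩
  set s := pdVal s' with hs'
  have hs : MapsProperly f (supp s) U := mapsProperly_supp_pdVal s'
  have hsx := hs.isCompact_fiber hf hx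
  have hfx : f ⁻¹' {x} ⊆ pre f U := fun y hy ↦ by
    change f y ∈ U
    rwa [show f y = x from hy]
  obtain ⟨V, hV, t, hCV, ht⟩ := exists_lift_near_compact hsep hlp hS h₁ hsx Set.inter_subset_right
    (Set.inter_subset_right.trans hfx) s
  obtain ⟨O₁, P, hO₁, hxO₁, hO₁U, hPV, hP, hCP⟩ := hlp.exists_mapsProperly hsx
    Set.inter_subset_right V.isOpen hCV U.isOpen hx
  obtain ⟨O₂, hO₂, hxO₂, hO₂P⟩ := hs.exists_tube hf hx isOpen_interior hCP
  -- Where `s` vanishes, the lift `t` comes from a section `a` of the first sheaf.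
  obtain ⟨a, ha⟩ := exists_app_f_eq hS.exact (res (inf_le_left : V ⊓ zeroOpens s ≤ V) t) (by
    rw [app_res, ht, res_res, ← res_res (zeroOpens_le s) inf_le_right, res_zeroOpens, map_zero])
  -- The points of the fiber of `P` outside its interior form a compact set that misses the support
  -- of `s`; there softness extends `a` to `a'`.
  obtain ⟨U₃, a', hx₃, -, B, hB, hBU, hDB, haB⟩ := h₁ x ((P ∩ f ⁻¹' {x}) \ interior P)
    (V ⊓ zeroOpens s) ((hP.isCompact_fiber hf hxO₁).diff isOpen_interior)
    (Set.sdiff_subset.trans Set.inter_subset_right)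
    (fun y hy ↦ ⟨hPV hy.1.1, hfx hy.1.2, fun hys ↦ hy.2 (hCP ⟨hys, hy.1.2⟩)⟩) a
  obtain ⟨O₄, hO₄, hxO₄, hO₄P⟩ := hP.exists_tube hf hxO₁ (isOpen_interior.union B.isOpen)
    (fun y hy ↦ by
      by_cases hyP : y ∈ interior P
      · exact Or.inl hyP
      · exact Or.inr (hDB ⟨hy, hyP⟩))
  -- Over `O₂` the support of `s` lies in the interior of `P`; over `O₄` the set `P` is covered by
  -- its interior and `B`.
  let U' : Opens X := ⟨O₁ ∩ O₂ ∩ O₄, (hO₁.inter hO₂).inter hO₄⟩ ⊓ U₃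
  have hU' : U' ≤ U := fun z hz ↦ hO₁U hz.1.1.1
  have hU'₃ : U' ≤ U₃ := inf_le_right
  have hPU' : MapsProperly f (P ∩ f ⁻¹' U') U' := hP.restrict hf fun z hz ↦ hz.1.1.1
  let A : Opens Y := pre f U' ⊓ (⟨interior P, isOpen_interior⟩ ⊔ B)
  have hAV : A ≤ V := by
    rintro y ⟨-, hy | hy⟩
    · exact hPV (interior_subset hy)
    · exact (hB hy).1
  have hAU : A ≤ pre f U' := inf_le_left
  -- On `B` the sections `a` and `a'` agree, so `t₀` vanishes there and its support stays in `P`;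
  -- its image is still `s`.
  let t₀ : Sec S.X₂ A := res hAV t - app S.f A (res (hAU.trans (pre_mono hU'₃)) a')
  have ht₀ : app S.g A t₀ = res (hAU.trans (pre_mono hU')) s := by
    rw [map_sub, app_g_f, sub_zero, app_res, ht, res_res]
  have ht₀' : ∀ y ∈ supp t₀, y ∈ P := by
    intro y hy
    by_contra hyP
    have hyA := supp_subset t₀ hy
    have hyB : y ∈ B := hyA.2.resolve_left fun h ↦ hyP (interior_subset h)
    refine (not_mem_supp_iff hyA).mpr ⟨A ⊓ B, inf_le_left, ⟨hyA, hyB⟩, ?_⟩ hy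
    have h := congrArg (fun b ↦ app S.f _ (res (inf_le_right : A ⊓ B ≤ B) b)) haB
    simp only [res_res] at h
    rw [app_res S.f _ a, ha, res_res] at h
    rw [map_sub, res_res, ← app_res, res_res, h, sub_self]
  obtain ⟨t', ht', hts⟩ := exists_extend_zero hAU t₀ (compl hsep hPU') (fun y hy ↦ hy.1)
    (fun y hy ↦ by
      by_cases hyP : y ∈ P
      · exact Or.inl ⟨hy, hO₄P ⟨hyP, hy.1.2⟩⟩
      · exact Or.inr ⟨hy, fun h ↦ hyP h.1⟩)
    (fun y hy hyt ↦ hy.2 ⟨ht₀' y hyt, hy.1⟩)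
  have htP : supp t' ⊆ P ∩ f ⁻¹' U' := fun y hy ↦ ⟨ht₀' y (hts ▸ hy), supp_subset t' hy⟩
  refine ⟨U', hU', ⟨⟨⟨hxO₁, hxO₂⟩, hxO₄⟩, hx₃⟩,
    pdMk t' (mapsProperly_supp_of_subset hPU' htP), pdVal_injective ?_⟩
  rw [pdVal_app, pdVal_pdMk, pdVal_res, ← hs']
  refine sec_ext fun y hy ↦ ?_
  by_cases hyP : y ∈ P
  · refine ⟨A, hAU, ⟨hy, hO₄P ⟨hyP, hy.1.2⟩⟩, ?_⟩
    rw [← app_res, ht', ht₀, res_res]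
  · have hle : compl hsep hPU' ≤ pre f U' := fun _ hz ↦ hz.1
    refine ⟨compl hsep hPU', hle, ⟨hy, fun h ↦ hyP h.1⟩, ?_⟩
    have h₁ : res hle t' = 0 := by
      rw [res_eq_zero_iff, Set.eq_empty_iff_forall_notMem]
      exact fun z hz ↦ hz.2.2 (htP hz.1)
    have h₂ : res (hle.trans (pre_mono hU')) s = 0 := by
      rw [res_eq_zero_iff, Set.eq_empty_iff_forall_notMem]
      exact fun z hz ↦ hz.2.2 ⟨interior_subset (hO₂P ⟨hz.1, hz.2.1.1.1.2⟩), hz.2.1⟩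
    rw [← app_res, h₁, map_zero, res_res, h₂]

theorem isAdaptedClass_isSoft (hsep : IsSeparatedMap f) (hlp : IsLocallyProperMap f) :
    IsAdaptedClass (properDirectImage f) (IsSoft f) where
  injective I _ := isSoft_of_injective hsep hlp I
  quotient _ hS h₁ h₂ := h₁.of_shortExact hsep hlp hS h₂
  epi_map _ hS h₁ := epi_properDirectImage_map hsep hlp hS h₁

end AbSheaf

theorem theoremt {Y X : TopCat.{u}} (f : Y ⟶ X)
    [HasDerivedCategory.{w₁} (TopCat.Sheaf AddCommGrpCat.{u} Y)]
    [HasDerivedCategory.{w₂} (TopCat.Sheaf AddCommGrpCat.{u} X)]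
    (hsep : IsSeparatedMap f) (hlp : IsLocallyProperMap f)
    (hfin : HasFiniteCohomologicalDimension f) :
    ∃ fUpperShriek : DerivedCategory.Plus (TopCat.Sheaf AddCommGrpCat.{u} X) ⥤
        DerivedCategory.Plus (TopCat.Sheaf AddCommGrpCat.{u} Y),
      Nonempty (derivedProperDirectImage f ⊣ fUpperShriek) := by
  obtain ⟨d, hd⟩ := hfin
  exact CategoryTheory.exists_rightAdjoint_rightDerivedFunctorPlus
    (AbSheaf.isAdaptedClass_isSoft hsep hlp)
    (CategoryTheory.FunctorialShortExact.ofMono (AbSheaf.toFinSheaf Y))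
    (AbSheaf.isSoft_finSheaf hsep hlp) d (hd (d + 1) d.lt_succ_self)
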